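/- Let $G=(V,E)$ be a finite simple graph with $n=|V|\ge 3$ vertices that is 2-vertex-connected. Let $LP(G)$ be the Held–Karp relaxation \[ \min \sum_{e\in E} x_e \quad\text{subject to } x(\delta(S))\ge 2 \text{ for all } \emptyset\ne S\subsetneq V,\ x_e\ge 0, \] let $\mathrm{OPT}_{LP}(G)$ be its optimum value, and let $x^*$ be an optimal solution of $LP(G)$ that is an extreme point of its feasible region and satisfies $x^*_e>0$ for every $e\in E$. Let $T$ be a depth-first search spanning tree of $G$, with any root $r$, obtained by always following, from the current vertex, an edge to an undiscovered vertex with the highest value of $x^*_e$ (ties broken arbitrarily). The network $C(G,T)$. Direct the edges of $T$ (tree-arcs) away from $r$ and all other edges of $G$ (back-arcs) towards $r$. For every non-root vertex $v$ and every child $w$ of $v$ in $T$, introduce a new vertex $v_w$, replace the tree-arc $(v,w)$ by the tree-arcs $(v,v_w)$ and $(v_w,w)$, and redirect to $v_w$ all back-arcs that enter $v$ from the subtree rooted at $w$. The root and the new vertices are the in-vertices, and $\mathcal I$ denotes their set; the other vertices are out-vertices. A circulation in $C(G,T)$ is a nonnegative flow on the arcs that is conserved at every vertex and is at least $1$ on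 every tree-arc. For an in-vertex $v$ let $B(v)$ be the set of back-arcs entering $v$. The cost of a flow $f$ is $|f|=\sum_{v\in\mathcal I}\max(f(B(v))-1,0)$. Each back-arc $a$ corresponds to an edge of $G$, whose value is written $x^*_a$, and forms with tree-arcs a unique directed cycle, called the cycle of $a$. The flows $f'$ and $f''$. The flow $f'$ sends $\min(x^*_a,1)$ units along the cycle of $a$, for each back-arc $a$. The flow $f''$ is built starting from $0$: as long as there is an arc $(v,w)$ from an out-vertex $v$ to an in-vertex $w$ on which the current total flow $f'+f''$ is less than $1$, choose such an arc and any back-arc $a$ from a descendant of $w$ to an ancestor of $v$, and add to $f''$ flow along the cycle of $a$ until the total flow on $(v,w)$ equals $1$. Then this construction can be carried out to its end, and for all choices made in it the resulting flow $f=f'+f''$ is a circulation in $C(G,T)$ whose cost satisfies \[ |f|\le \tfrac53\,\mathrm{OPT}_{LP}(G)-\tfrac32\,n. \] -/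

import Mathlib

/-- A graph is 2-vertex-connected: it has at least three vertices, is connected, and stays
connected after the removal of any one vertex. -/
def TwoVertexConnected {V : Type*} [Fintype V] (G : SimpleGraph V) : Prop :=
  3 ≤ Fintype.card V ∧ G.Connected ∧ ∀ v : V, (G.induce ({v}ᶜ : Set V)).Connected

namespace HeldKarp

variable {V : Type*} [Fintype V]

/-- The edge `e` belongs to the cut `δ(S)`. -/
def Crosses (S : Finset V) (e : Sym2 V) : Prop :=
  ∃ u v : V, u ∈ S ∧ v ∉ S ∧ e = s(u, v)

open Classical in
/-- `x(δ(S))`. -/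
noncomputable def cutValue (G : SimpleGraph V) (x : G.edgeSet → ℝ) (S : Finset V) : ℝ :=
  ∑ e ∈ Finset.univ.filter (fun e : G.edgeSet => Crosses S e.1), x e

/-- The feasible region of the Held-Karp linear program `LP(G)`. -/
def feasible (G : SimpleGraph V) : Set (G.edgeSet → ℝ) :=
  {x | (∀ e, 0 ≤ x e) ∧ ∀ S : Finset V, S.Nonempty → S ≠ Finset.univ → 2 ≤ cutValue G x S}

open Classical in
/-- The objective function of `LP(G)`. -/
noncomputable def objective (G : SimpleGraph V) (x : G.edgeSet → ℝ) : ℝ :=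
  ∑ e, x e

/-- The optimum value of `LP(G)`. -/
noncomputable def optLP (G : SimpleGraph V) : ℝ :=
  sInf (objective G '' feasible G)

/-- `x` is an optimal solution of `LP(G)` and an extreme point of its feasible region. -/
def IsExtremeOptimal (G : SimpleGraph V) (x : G.edgeSet → ℝ) : Prop :=
  x ∈ (feasible G).extremePoints ℝ ∧ IsMinOn (objective G) (feasible G) x

end HeldKarp

open Classical in
/-- The value of `x` on the edge `{u, v}` (`0` if `u` and `v` are not adjacent). -/
noncomputable def edgeValue {V : Type*} {G : SimpleGraph V} (x : G.edgeSet → ℝ) (u v : V) : ℝ :=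
  if h : G.Adj u v then x ⟨s(u, v), h⟩ else 0

/-- A depth-first search spanning tree of `G`, recorded by its root, its parent function and the
discovery times. At the moment at which `v` is discovered, the undiscovered vertices are
the `w` with `disc v ≤ disc w`. Depth-first search discovers `v` along an edge from `parent v`,
which is the most recently discovered vertex that still has an undiscovered neighbour.
(The value of `parent` at the root has no meaning and is fixed by convention.) -/
structure DFSTree {V : Type*} (G : SimpleGraph V) where
  root : V
  parent : V → V
  disc : V → ℕ
  disc_injective : Function.Injective disc
  disc_root_le : ∀ v, disc root ≤ disc v
  parent_root : parent root = root
  adj_parent : ∀ v, v ≠ root → G.Adj (parent v) v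
  disc_parent_lt : ∀ v, v ≠ root → disc (parent v) < disc v
  most_recent : ∀ v, v ≠ root → ∀ u w, disc u < disc v → disc v ≤ disc w → G.Adj u w →
    disc u ≤ disc (parent v)

namespace DFSTree

variable {V : Type*} {G : SimpleGraph V} (T : DFSTree G)

/-- The search always follows an edge of highest value: when `v` is discovered from `parent v`,
no edge from `parent v` to an undiscovered vertex has a larger value. -/
def FollowsHighest (x : G.edgeSet → ℝ) : Prop :=
  ∀ v, v ≠ T.root → ∀ w, G.Adj (T.parent v) w → T.disc v ≤ T.disc w →
    edgeValue x (T.parent v) w ≤ edgeValue x (T.parent v) v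

/-- `a` is an ancestor of `b` in the tree, or `a = b`. -/
def IsAncestor (a b : V) : Prop :=
  Relation.ReflTransGen (fun u v => v ≠ T.root ∧ T.parent v = u) a b

/-- The vertices of the network `C(G,T)`: the vertices of `G`, and for every child `w` of a
non-root vertex `v` one new vertex, which subdivides the tree-arc `(v, w)`. -/
abbrev Node : Type _ :=
  V ⊕ {w : V // w ≠ T.root ∧ T.parent w ≠ T.root}

/-- The in-vertices of `C(G,T)` are the root and the new vertices; the others are out-vertices. -/
def IsIn : T.Node → Prop
  | Sum.inl v => v = T.root
  | Sum.inr _ => True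

/-- The vertex of `G` from whose gadget a vertex of `C(G,T)` comes. -/
def base : T.Node → V
  | Sum.inl v => v
  | Sum.inr w => T.parent w

/-- The tree-arcs of `C(G,T)`. -/
inductive TreeArc : T.Node → T.Node → Prop
  | fromRoot (w : V) (hw : w ≠ T.root) (h : T.parent w = T.root) :
      TreeArc (Sum.inl T.root) (Sum.inl w)
  | upper (w : {w : V // w ≠ T.root ∧ T.parent w ≠ T.root}) :
      TreeArc (Sum.inl (T.parent w)) (Sum.inr w)
  | lower (w : {w : V // w ≠ T.root ∧ T.parent w ≠ T.root}) :
      TreeArc (Sum.inr w) (Sum.inl w)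

/-- The back-arcs of `C(G,T)`. A non-tree edge between `u` and the root becomes an arc from `u` to
the root. A non-tree edge between a non-root vertex `v` and a vertex `u` of the subtree of a child
`w` of `v` becomes an arc from `u` to the new vertex on the tree-arc `(v, w)`. -/
inductive BackArc : T.Node → T.Node → Prop
  | toRoot (u : V) (h : G.Adj u T.root) (hu : T.parent u ≠ T.root) :
      BackArc (Sum.inl u) (Sum.inl T.root)
  | toNew (u : V) (w : {w : V // w ≠ T.root ∧ T.parent w ≠ T.root})
      (h : G.Adj u (T.parent w)) (hu : u ≠ w) (hwu : T.IsAncestor w u) :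
      BackArc (Sum.inl u) (Sum.inr w)

/-- There is a directed path of tree-arcs from `p` to `q` in `C(G,T)`. -/
def Reach (p q : T.Node) : Prop :=
  Relation.ReflTransGen T.TreeArc p q

open Classical in
/-- The unit flow along the unique cycle formed by the back-arc `(p, q)` and tree-arcs, that is, by
`(p, q)` and the path of tree-arcs from `q` to `p`. -/
noncomputable def cycleFlow (p q : T.Node) : T.Node → T.Node → ℝ := fun c d =>
  if (c = p ∧ d = q) ∨ (T.TreeArc c d ∧ T.Reach q c ∧ T.Reach d p) then 1 else 0

variable [Fintype V]

open Classical in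
/-- `f(B(v))`, the total flow on the back-arcs that enter `v`. -/
noncomputable def backInflow (f : T.Node → T.Node → ℝ) (v : T.Node) : ℝ :=
  ∑ p : T.Node with T.BackArc p v, f p v

open Classical in
/-- The cost of a flow: at each in-vertex the first unit that enters on back-arcs is free, and any
further unit costs `1`. -/
noncomputable def cost (f : T.Node → T.Node → ℝ) : ℝ :=
  ∑ v : T.Node with T.IsIn v, max (T.backInflow f v - 1) 0

open Classical in
/-- `f` is a circulation in `C(G,T)`: a nonnegative flow on the arcs that is conserved at every
vertex and satisfies the demand `1` of every tree-arc. -/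
def IsCirculation (f : T.Node → T.Node → ℝ) : Prop :=
  (∀ c d, 0 ≤ f c d) ∧
  (∀ c d, ¬ T.TreeArc c d → ¬ T.BackArc c d → f c d = 0) ∧
  (∀ c, ∑ d, f d c = ∑ d, f c d) ∧
  (∀ c d, T.TreeArc c d → 1 ≤ f c d)

open Classical in
/-- The core flow `f'`: for every back-arc `a`, send `min(x_a, 1)` along the cycle of `a`. -/
noncomputable def coreFlow (x : G.edgeSet → ℝ) : T.Node → T.Node → ℝ := fun c d =>
  ∑ a : T.Node × T.Node with T.BackArc a.1 a.2,
    min (edgeValue x (T.base a.1) (T.base a.2)) 1 * T.cycleFlow a.1 a.2 c d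

/-- The flows that arise while the correction flow `f''` is being built, starting from `0`. In one
step one chooses an arc `(v, w)` from an out-vertex to an in-vertex that carries less than `1` unit
of the current total flow, and a back-arc `(p, q)` from a descendant `p` of `w` to an
ancestor `q` of `v`, and pushes flow along the cycle of `(p, q)` until `(v, w)` carries `1`. -/
inductive PartialCorrection (x : G.edgeSet → ℝ) : (T.Node → T.Node → ℝ) → Prop
  | zero : PartialCorrection x 0
  | push (g : T.Node → T.Node → ℝ) (v w p q : T.Node) (hg : PartialCorrection x g)
      (hv : ¬ T.IsIn v) (hw : T.IsIn w) (hvw : T.TreeArc v w)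
      (hlt : (T.coreFlow x + g) v w < 1)
      (hpq : T.BackArc p q) (hp : T.Reach w p) (hq : T.Reach q v) :
      PartialCorrection x (g + (1 - (T.coreFlow x + g) v w) • T.cycleFlow p q)

/-- `g` is a possible final result `f''` of the correction: no arc from an out-vertex to an
in-vertex carries less than `1` unit of `f' + g` any more. -/
def IsCorrection (x : G.edgeSet → ℝ) (g : T.Node → T.Node → ℝ) : Prop :=
  T.PartialCorrection x g ∧
    ∀ v w, ¬ T.IsIn v → T.IsIn w → T.TreeArc v w → 1 ≤ (T.coreFlow x + g) v w

end DFSTree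

/-! The cost and the shortfall of the arcs from out-vertices to in-vertices (`deficit`) balance
during the correction: a push of t units feeds a single in-vertex, so it raises the cost by at most
t, and it lowers the deficit by at least t. Hence the final cost is at most the cost plus the
deficit of the core flow, whatever choices are made (`PartialCorrection.isFlow_and_cost_le`). A
suitable back-arc always exists by 2-connectivity, and every push completes one arc for good, so the
construction ends.

It remains to bound cost plus deficit of the core flow (`cost_add_deficit_le`). For a child w of v,
let k be the number of back-arcs from the subtree of w to v, b their core flow (`coreInflow`), q the
value of all edges from the subtree to v (`parentValue`), and u the value of those leading above v
(`aboveValue`). For non-root v the child contributes at most max(b - 1, 0) + max(1 - u, 0). The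
search rule makes the tree edge the heaviest among the edges counted by q, so b ≤ k m with m its
truncated value. Together with the cut constraint q + u ≥ 2 this shows that the contribution, less
k/6, is at most 5/6 max(q - u, 0) or 5/6 (q - 2) (`local_cost_le`).

Summed over the children of v, these amounts are at most 5/6 (x(δ(v)) - 2): use the cut of v
together with the subtrees having q ≥ u, or, if some child needs the second alternative, the bound
of the sum of q by x(δ(v)) (`sum_cost_children_le`). The root has one child and no deficit, and
obeys the same bound. Summing over v gives 5/3 OPT - 5/3 n.

The sixths paid by back-arcs total at most (|E| - (n - 1))/6. An extreme point with full support has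
at most 2n - 2 edges, since uncrossing lets a laminar family of tight cuts determine it
(`card_edgeSet_le`). So they add at most (n - 1)/6, which is less than 5/3 n - 3/2 n. -/

namespace DFSTree

variable {V : Type*} {G : SimpleGraph V} (T : DFSTree G)

/-! ### Ancestors in a depth-first search tree, and what 2-connectivity says about them. -/

lemma ne_root_of_disc_lt {u v : V} (h : T.disc u < T.disc v) : v ≠ T.root := by
  rintro rfl
  exact absurd (T.disc_root_le u) (by omega)

lemma IsAncestor.disc_le {a b : V} (h : T.IsAncestor a b) : T.disc a ≤ T.disc b := by
  induction h with
  | refl => exact le_rfl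
  | tail _ h ih =>
    obtain ⟨h1, rfl⟩ := h
    exact ih.trans (T.disc_parent_lt _ h1).le

lemma IsAncestor.refl (a : V) : T.IsAncestor a a := Relation.ReflTransGen.refl

variable {T}

lemma IsAncestor.trans {a b c : V} (h : T.IsAncestor a b) (h' : T.IsAncestor b c) :
    T.IsAncestor a c := Relation.ReflTransGen.trans h h'

lemma IsAncestor.antisymm {a b : V} (h : T.IsAncestor a b) (h' : T.IsAncestor b a) : a = b :=
  T.disc_injective (le_antisymm h.disc_le h'.disc_le)

lemma isAncestor_parent {w : V} (hw : w ≠ T.root) : T.IsAncestor (T.parent w) w :=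
  Relation.ReflTransGen.single ⟨hw, rfl⟩

/-- A strict ancestor of `w` is an ancestor of the parent of `w`. -/
lemma IsAncestor.parent_right {a w : V} (h : T.IsAncestor a w) (hne : a ≠ w) :
    w ≠ T.root ∧ T.IsAncestor a (T.parent w) := by
  rcases Relation.ReflTransGen.cases_tail h with rfl | ⟨c, hc, h1, rfl⟩
  · exact absurd rfl hne
  · exact ⟨h1, hc⟩

lemma IsAncestor.exists_child {a b : V} (h : T.IsAncestor a b) (hne : a ≠ b) :
    ∃ w, w ≠ T.root ∧ T.parent w = a ∧ T.IsAncestor w b := by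
  rcases Relation.ReflTransGen.cases_head h with rfl | ⟨c, ⟨h1, h2⟩, hc⟩
  · exact absurd rfl hne
  · exact ⟨c, h1, h2, hc⟩

lemma IsAncestor.total {a b c : V} (h : T.IsAncestor a c) (h' : T.IsAncestor b c) :
    T.IsAncestor a b ∨ T.IsAncestor b a := by
  induction h' with
  | refl => exact Or.inl h
  | tail hb hc ih =>
    rename_i d e
    by_cases hae : a = e
    · subst hae
      exact Or.inr (hb.tail hc)
    · have := (h.parent_right hae).2
      rw [hc.2] at this
      exact ih this

variable (T) in
lemma root_isAncestor (v : V) : T.IsAncestor T.root v := by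
  induction h : T.disc v using Nat.strong_induction_on generalizing v with
  | _ n ih =>
    by_cases hv : v = T.root
    · subst hv; exact .refl T _
    · exact (ih _ (h ▸ T.disc_parent_lt v hv) _ rfl).trans (isAncestor_parent hv)

/-- The edges of `G` join vertices of which one is an ancestor of the other. -/
lemma isAncestor_of_adj {a b : V} (hab : G.Adj a b) (h : T.disc a < T.disc b) :
    T.IsAncestor a b := by
  -- Climb from `b` towards the root. While the current vertex `v` is discovered after `a`, the edge
  -- from `a` to `b` makes `a` a candidate for the parent of `v`, so that parent is no older than
  -- `a`; the climb cannot jump over `a`.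
  suffices H : ∀ n v, T.disc v = n → T.IsAncestor v b → T.disc a ≤ T.disc v →
      T.IsAncestor a v from H _ b rfl (.refl T b) h.le
  intro n
  induction n using Nat.strong_induction_on with
  | _ n ih =>
    rintro v rfl hvb hav
    rcases hav.eq_or_lt with h1 | h1
    · rw [T.disc_injective h1]; exact .refl T _
    · have hv := T.ne_root_of_disc_lt h1
      exact (ih _ (T.disc_parent_lt v hv) _ rfl ((isAncestor_parent hv).trans hvb)
        (T.most_recent v hv a b h1 hvb.disc_le hab)).trans (isAncestor_parent hv)

/-- An edge that leaves the subtree of `w` leads to a strict ancestor of `w`. -/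
lemma isAncestor_parent_of_adj {w a t : V} (ha : T.IsAncestor w a)
    (ht : ¬ T.IsAncestor w t) (hat : G.Adj a t) : T.IsAncestor t (T.parent w) := by
  have hta : T.IsAncestor t a := by
    rcases lt_trichotomy (T.disc a) (T.disc t) with h | h | h
    · exact absurd (ha.trans (isAncestor_of_adj hat h)) ht
    · exact absurd (T.disc_injective h) hat.ne
    · exact isAncestor_of_adj hat.symm h
  rcases hta.total ha with h | h
  · exact (h.parent_right (by rintro rfl; exact ht (.refl T _))).2
  · exact absurd h ht

lemma not_isAncestor_parent {w : V} (hw : w ≠ T.root) : ¬ T.IsAncestor w (T.parent w) := fun h =>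
  absurd h.disc_le (not_le.mpr (T.disc_parent_lt w hw))

lemma eq_of_isAncestor_of_parent_eq {w w' a : V} (hw : w ≠ T.root) (hw' : w' ≠ T.root)
    (hp : T.parent w = T.parent w') (h : T.IsAncestor w a) (h' : T.IsAncestor w' a) : w = w' := by
  by_contra hne
  rcases h.total h' with h1 | h1
  · exact not_isAncestor_parent hw (hp ▸ (h1.parent_right hne).2)
  · exact not_isAncestor_parent hw' (hp ▸ (h1.parent_right (Ne.symm hne)).2)

lemma eq_of_isAncestor_root {v : V} (h : T.IsAncestor v T.root) : v = T.root :=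
  h.antisymm (T.root_isAncestor v)

lemma parent_ne_self {w : V} (hw : w ≠ T.root) : T.parent w ≠ w := (T.adj_parent w hw).ne

/-- In a connected `G - v` some edge leaves a set of vertices that avoids `v`, unless it is all
of `G - v`. -/
lemma exists_adj_of_connected_induce {v : V} (h : (G.induce ({v}ᶜ : Set V)).Connected) {S : Set V}
    {a b : V} (ha : a ∈ S) (hb : b ∉ S) (hav : a ≠ v) (hbv : b ≠ v) :
    ∃ c t, c ∈ S ∧ t ∉ S ∧ t ≠ v ∧ G.Adj c t := by
  obtain ⟨p⟩ := h.preconnected ⟨a, hav⟩ ⟨b, hbv⟩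
  obtain ⟨d, -, h1, h2⟩ := p.exists_boundary_dart (Subtype.val ⁻¹' S) ha hb
  exact ⟨d.fst, d.snd, h1, h2, d.snd.2, d.adj⟩

/-- Deleting the parent of `w` leaves the subtree of `w` connected to the root, and edges that leave
a subtree go to ancestors only. This edge supplies the back-arc for a correction step. -/
lemma exists_adj_above [Fintype V] (hG : TwoVertexConnected G) {w : V} (hw : w ≠ T.root)
    (hpw : T.parent w ≠ T.root) :
    ∃ a t, T.IsAncestor w a ∧ t ≠ T.parent w ∧ T.IsAncestor t (T.parent w) ∧ G.Adj a t := by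
  obtain ⟨a, t, ha, ht, htv, hat⟩ := exists_adj_of_connected_induce (hG.2.2 (T.parent w))
    (S := {a | T.IsAncestor w a}) (IsAncestor.refl T w)
    (fun h => hw (eq_of_isAncestor_root h)) (parent_ne_self hw).symm hpw.symm
  exact ⟨a, t, ha, htv, isAncestor_parent_of_adj ha ht hat, hat⟩

/-- In a 2-connected graph the whole tree hangs below a single child of the root. -/
lemma isAncestor_of_parent_eq_root [Fintype V] (hG : TwoVertexConnected G) {w : V}
    (hw : w ≠ T.root) (hpw : T.parent w = T.root) {v : V} (hv : v ≠ T.root) :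
    T.IsAncestor w v := by
  by_contra h
  obtain ⟨a, t, ha, ht, htv, hat⟩ := exists_adj_of_connected_induce (hG.2.2 T.root)
    (S := {a | T.IsAncestor w a}) (IsAncestor.refl T w) h hw hv
  have := isAncestor_parent_of_adj ha ht hat
  rw [hpw] at this
  exact htv (eq_of_isAncestor_root this)

lemma exists_child_root [Fintype V] (hG : TwoVertexConnected G) :
    ∃ w, w ≠ T.root ∧ T.parent w = T.root := by
  obtain ⟨v, hv⟩ := Fintype.exists_ne_of_one_lt_card (by have := hG.1; omega) T.root
  obtain ⟨w, h1, h2, -⟩ := (T.root_isAncestor v).exists_child hv.symm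
  exact ⟨w, h1, h2⟩

/-- The child of the root has a child. -/
lemma exists_grandchild_root [Fintype V] (hG : TwoVertexConnected G) {w : V}
    (hw : w ≠ T.root) (hpw : T.parent w = T.root) : ∃ c, c ≠ T.root ∧ T.parent c = w := by
  classical
  obtain ⟨v, hv⟩ : ∃ v, v ∉ ({T.root, w} : Finset V) := by
    by_contra! h
    have h1 := Finset.card_le_card (fun v _ => h v : Finset.univ ⊆ ({T.root, w} : Finset V))
    have h2 := Finset.card_le_two (a := T.root) (b := w)
    have := hG.1
    rw [Finset.card_univ] at h1
    omega
  simp only [Finset.mem_insert, Finset.mem_singleton, not_or] at hv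
  obtain ⟨c, h1, h2, -⟩ := (isAncestor_of_parent_eq_root hG hw hpw hv.1).exists_child
    (Ne.symm hv.2)
  exact ⟨c, h1, h2⟩

end DFSTree

/-! ### Laminar families. -/

/-- A laminar family of nonempty subsets of a set of `n` elements has at most `2 n` members. -/
lemma Finset.card_le_of_laminar {α : Type*} [DecidableEq α] (U : Finset α)
    (L : Finset (Finset α)) (hU : ∀ A ∈ L, A.Nonempty ∧ A ⊆ U)
    (hL : ∀ A ∈ L, ∀ B ∈ L, (A ∩ B).Nonempty → A ⊆ B ∨ B ⊆ A) : L.card ≤ 2 * U.card := by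
  induction U using Finset.induction_on generalizing L with
  | empty =>
    have : L = ∅ := by
      by_contra h
      obtain ⟨A, hA⟩ := Finset.nonempty_iff_ne_empty.mpr h
      obtain ⟨⟨x, hx⟩, h2⟩ := hU A hA
      exact absurd (h2 hx) (Finset.notMem_empty x)
    simp [this]
  | insert a U ha ih =>
    -- Outside `P` and the singleton `{a}`, erasing `a` keeps the members nonempty and distinct. So
    -- removing `a` from the ground set costs at most two members, once `P` has at most one.
    set P := L.filter fun A => a ∈ A ∧ A.erase a ∈ L with hP
    have hP1 : P.card ≤ 1 := by
      have key : ∀ A ∈ P, ∀ B ∈ P, A ⊆ B → A = B := by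
        intro A hA B hB hAB
        obtain ⟨hA1, hA2, hA3⟩ := Finset.mem_filter.mp hA
        obtain ⟨hB1, hB2, hB3⟩ := Finset.mem_filter.mp hB
        refine hAB.antisymm ?_
        obtain ⟨v, hv⟩ := (hU _ hA3).1
        have hv' := Finset.mem_erase.mp hv
        -- `B.erase a` belongs to the family and meets `A`, because `A.erase a` is nonempty. It
        -- cannot contain `A`, which has `a`, so it lies in `A`.
        rcases hL A hA1 _ hB3 ⟨v, Finset.mem_inter.mpr
          ⟨hv'.2, Finset.mem_erase.mpr ⟨hv'.1, hAB hv'.2⟩⟩⟩ with h | h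
        · exact absurd (h hA2) (Finset.notMem_erase a B)
        · rw [← Finset.insert_erase hB2]
          exact Finset.insert_subset hA2 h
      refine Finset.card_le_one.mpr fun A hA B hB => ?_
      obtain ⟨hA1, hA2, -⟩ := Finset.mem_filter.mp hA
      obtain ⟨hB1, hB2, -⟩ := Finset.mem_filter.mp hB
      rcases hL A hA1 B hB1 ⟨a, Finset.mem_inter.mpr ⟨hA2, hB2⟩⟩ with h | h
      exacts [key A hA B hB h, (key B hB A hA h).symm]
    have hmem : ∀ A ∈ (L \ P).erase {a}, A ∈ L ∧ A ≠ {a} ∧ (a ∈ A → A.erase a ∉ L) := by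
      intro A hA
      simp only [hP, Finset.mem_erase, Finset.mem_sdiff, Finset.mem_filter, not_and] at hA
      exact ⟨hA.2.1, hA.1, hA.2.2 hA.2.1⟩
    have h1 := ih (((L \ P).erase {a}).image fun A => A.erase a) (by
        intro B hB
        obtain ⟨A, hA, rfl⟩ := Finset.mem_image.mp hB
        obtain ⟨hA1, hA2, -⟩ := hmem A hA
        refine ⟨?_, Finset.subset_insert_iff.mp (hU A hA1).2⟩
        rw [Finset.nonempty_iff_ne_empty, Ne, Finset.erase_eq_empty_iff]
        exact not_or.mpr ⟨(hU A hA1).1.ne_empty, hA2⟩) (by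
        intro A' hA' B' hB' h
        obtain ⟨A, hA, rfl⟩ := Finset.mem_image.mp hA'
        obtain ⟨B, hB, rfl⟩ := Finset.mem_image.mp hB'
        exact (hL A (hmem A hA).1 B (hmem B hB).1 (h.mono
          (Finset.inter_subset_inter (Finset.erase_subset _ _) (Finset.erase_subset _ _)))).imp
          (Finset.erase_subset_erase a) (Finset.erase_subset_erase a))
    rw [Finset.card_image_of_injOn] at h1
    · have h2 := Finset.pred_card_le_card_erase (s := L \ P) (a := {a})
      have h3 := Finset.le_card_sdiff P L
      rw [Finset.card_insert_of_notMem ha]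
      omega
    · intro A hA B hB h
      obtain ⟨hA1, -, hA3⟩ := hmem A hA
      obtain ⟨hB1, -, hB3⟩ := hmem B hB
      simp only at h
      by_cases haA : a ∈ A <;> by_cases haB : a ∈ B
      · rw [← Finset.insert_erase haA, h, Finset.insert_erase haB]
      · rw [Finset.erase_eq_of_notMem haB] at h
        exact absurd (h ▸ hB1) (hA3 haA)
      · rw [Finset.erase_eq_of_notMem haA] at h
        exact absurd (h ▸ hA1) (hB3 haB)
      · rwa [Finset.erase_eq_of_notMem haA, Finset.erase_eq_of_notMem haB] at h

/-! ### Cut values, uncrossing, and the number of edges of an extreme point. -/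

namespace HeldKarp

variable {V : Type*} {G : SimpleGraph V}

lemma edgeValue_of_adj (x : G.edgeSet → ℝ) {a b : V} (h : G.Adj a b) :
    edgeValue x a b = x ⟨s(a, b), h⟩ := dif_pos h

lemma edgeValue_of_not_adj (x : G.edgeSet → ℝ) {a b : V} (h : ¬ G.Adj a b) :
    edgeValue x a b = 0 := dif_neg h

lemma edgeValue_comm (x : G.edgeSet → ℝ) (a b : V) : edgeValue x a b = edgeValue x b a := by
  by_cases h : G.Adj a b
  · rw [edgeValue_of_adj x h, edgeValue_of_adj x h.symm]
    congr 2
    exact Sym2.eq_swap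
  · rw [edgeValue_of_not_adj x h, edgeValue_of_not_adj x (fun h' => h h'.symm)]

lemma edgeValue_nonneg {x : G.edgeSet → ℝ} (hx : ∀ e, 0 ≤ x e) (a b : V) :
    0 ≤ edgeValue x a b := by
  unfold edgeValue
  split_ifs
  exacts [hx _, le_rfl]

lemma edgeValue_pos {x : G.edgeSet → ℝ} (hx : ∀ e, 0 < x e) {a b : V} (h : G.Adj a b) :
    0 < edgeValue x a b := by
  rw [edgeValue_of_adj x h]; exact hx _

/-- `A` and `B` cross: they intersect and neither contains the other. -/
def Crossing (A B : Finset V) : Prop := (∃ v, v ∈ A ∧ v ∈ B) ∧ ¬ A ⊆ B ∧ ¬ B ⊆ A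

lemma Crossing.symm {A B : Finset V} (h : Crossing A B) : Crossing B A :=
  ⟨h.1.imp fun _ h => h.symm, h.2.2, h.2.1⟩

variable [Fintype V]

open Classical in
lemma cutValue_eq (x : G.edgeSet → ℝ) (S : Finset V) :
    cutValue G x S = ∑ a ∈ S, ∑ b ∈ Sᶜ, edgeValue x a b := by
  rw [← Finset.sum_product', ← Finset.sum_filter_of_ne (p := fun p => G.Adj p.1 p.2)
    (fun p _ hp => by by_contra h; exact hp (edgeValue_of_not_adj x h)), cutValue, eq_comm]
  refine Finset.sum_bij (fun p hp => ⟨s(p.1, p.2), (Finset.mem_filter.mp hp).2⟩) ?_ ?_ ?_ ?_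
  · intro p hp
    simp only [Finset.mem_filter, Finset.mem_product, Finset.mem_compl] at hp
    simp only [Finset.mem_filter, Finset.mem_univ, true_and]
    exact ⟨p.1, p.2, hp.1.1, hp.1.2, rfl⟩
  · rintro ⟨a, b⟩ hp ⟨c, d⟩ hq h
    simp only [Finset.mem_filter, Finset.mem_product, Finset.mem_compl] at hp hq
    rcases Sym2.eq_iff.mp (congrArg Subtype.val h) with ⟨rfl, rfl⟩ | ⟨rfl, rfl⟩
    · rfl
    · exact absurd hp.1.1 hq.1.2
  · rintro ⟨e, he⟩ h
    simp only [Finset.mem_filter, Finset.mem_univ, true_and] at h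
    obtain ⟨u, v, hu, hv, rfl⟩ := h
    exact ⟨(u, v), by simpa [hu, hv] using he, rfl⟩
  · intro p hp
    exact edgeValue_of_adj x (Finset.mem_filter.mp hp).2

open Classical in
lemma cutValue_singleton (x : G.edgeSet → ℝ) (v : V) :
    cutValue G x {v} = ∑ b, edgeValue x v b := by
  rw [cutValue_eq, Finset.sum_singleton]
  refine Finset.sum_subset (Finset.subset_univ _) fun b _ hb => ?_
  rw [Finset.mem_compl, not_not, Finset.mem_singleton] at hb
  exact edgeValue_of_not_adj x (by simp [hb])

open Classical in
lemma cutValue_compl (x : G.edgeSet → ℝ) (S : Finset V) : cutValue G x Sᶜ = cutValue G x S := by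
  rw [cutValue_eq, cutValue_eq, compl_compl, Finset.sum_comm]
  exact Finset.sum_congr rfl fun a _ => Finset.sum_congr rfl fun b _ => edgeValue_comm x _ _

lemma cutValue_add_smul (x z : G.edgeSet → ℝ) (t : ℝ) (S : Finset V) :
    cutValue G (x + t • z) S = cutValue G x S + t * cutValue G z S := by
  simp [cutValue, Finset.sum_add_distrib, Finset.mul_sum]

lemma sum_cutValue_singleton (x : G.edgeSet → ℝ) :
    ∑ v, cutValue G x {v} = 2 * objective G x := by
  classical
  unfold cutValue objective
  simp_rw [Finset.sum_filter]
  rw [Finset.sum_comm, Finset.mul_sum]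
  refine Finset.sum_congr (by congr!) fun e _ => ?_
  obtain ⟨e, he⟩ := e
  induction e with
  | _ a b =>
    have hab : a ≠ b := SimpleGraph.Adj.ne he
    have : ∀ v, Crosses {v} s(a, b) ↔ v ∈ ({a, b} : Finset V) := by
      intro v
      simp only [Crosses, Finset.mem_singleton, Finset.mem_insert]
      constructor
      · rintro ⟨u, w, rfl, hw, h⟩
        rw [Sym2.eq_iff] at h
        rcases h with ⟨rfl, -⟩ | ⟨-, rfl⟩ <;> simp
      · rintro (rfl | rfl)
        · exact ⟨v, b, rfl, hab.symm, rfl⟩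
        · exact ⟨v, a, rfl, hab, Sym2.eq_swap⟩
    simp_rw [this]
    rw [Finset.sum_ite_mem, Finset.univ_inter, Finset.sum_const, Finset.card_pair hab]
    simp

open Classical in
/-- The cut function is submodular; the defect counts the edges between `A \ B` and `B \ A`. -/
lemma cutValue_add_cutValue (x : G.edgeSet → ℝ) (A B : Finset V) :
    cutValue G x A + cutValue G x B = cutValue G x (A ∩ B) + cutValue G x (A ∪ B) +
      ∑ a, ∑ b, if (a ∈ A \ B ∧ b ∈ B \ A) ∨ (a ∈ B \ A ∧ b ∈ A \ B)
        then edgeValue x a b else 0 := by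
  have key : ∀ S : Finset V, cutValue G x S =
      ∑ a, ∑ b, if a ∈ S ∧ b ∉ S then edgeValue x a b else 0 := by
    intro S
    rw [cutValue_eq, ← Finset.sum_subset (Finset.subset_univ S)]
    · refine Finset.sum_congr rfl fun a ha => ?_
      rw [← Finset.sum_subset (Finset.subset_univ Sᶜ)]
      · exact Finset.sum_congr rfl fun b hb => by rw [if_pos ⟨ha, Finset.mem_compl.mp hb⟩]
      · intro b _ hb
        rw [if_neg]
        simpa [ha] using hb
    · intro a _ ha
      exact Finset.sum_eq_zero fun b _ => if_neg (by simp [ha])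
  simp_rw [key, ← Finset.sum_add_distrib]
  refine Finset.sum_congr rfl fun a _ => Finset.sum_congr rfl fun b _ => ?_
  by_cases h1 : a ∈ A <;> by_cases h2 : a ∈ B <;> by_cases h3 : b ∈ A <;> by_cases h4 : b ∈ B <;>
    simp [h1, h2, h3, h4]

/-- The constraint of the set `S` is tight at `x`, and `S` avoids the vertex `r`. -/
def IsTight (x : G.edgeSet → ℝ) (r : V) (S : Finset V) : Prop :=
  S.Nonempty ∧ r ∉ S ∧ cutValue G x S = 2

open Classical in
-- Feasibility of the intersection and the union leaves no room for the submodular defect, so it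
-- vanishes at `x`. As `x` is positive on all edges, no edge joins `A \ B` to `B \ A`, and the
-- defect vanishes for every `z`.
lemma IsTight.uncross {x : G.edgeSet → ℝ} (hx : x ∈ feasible G) (hpos : ∀ e, 0 < x e) {r : V}
    {A B : Finset V} (hA : IsTight x r A) (hB : IsTight x r B) (hAB : (A ∩ B).Nonempty) :
    IsTight x r (A ∩ B) ∧ IsTight x r (A ∪ B) ∧ ∀ z : G.edgeSet → ℝ,
      cutValue G z A + cutValue G z B = cutValue G z (A ∩ B) + cutValue G z (A ∪ B) := by
  obtain ⟨hA1, hA2, hA3⟩ := hA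
  obtain ⟨hB1, hB2, hB3⟩ := hB
  have hi : r ∉ A ∩ B := fun h => hA2 (Finset.mem_inter.mp h).1
  have hu : r ∉ A ∪ B := fun h => (Finset.mem_union.mp h).elim hA2 hB2
  have hu1 : (A ∪ B).Nonempty := hA1.mono Finset.subset_union_left
  have h1 := hx.2 _ hAB fun h => hi (h ▸ Finset.mem_univ r)
  have h2 := hx.2 _ hu1 fun h => hu (h ▸ Finset.mem_univ r)
  have h3 := cutValue_add_cutValue x A B
  have hnn : ∀ a b, 0 ≤ if (a ∈ A \ B ∧ b ∈ B \ A) ∨ (a ∈ B \ A ∧ b ∈ A \ B)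
        then edgeValue x a b else 0 := fun a b => by
    split_ifs
    exacts [edgeValue_nonneg hx.1 a b, le_rfl]
  have h4 := Finset.sum_nonneg fun a (_ : a ∈ Finset.univ) =>
    Finset.sum_nonneg fun b (_ : b ∈ Finset.univ) => hnn a b
  refine ⟨⟨hAB, hi, by linarith⟩, ⟨hu1, hu, by linarith⟩, fun z => ?_⟩
  rw [cutValue_add_cutValue z A B, add_eq_left]
  have h5 : ∑ a, ∑ b, (if (a ∈ A \ B ∧ b ∈ B \ A) ∨ (a ∈ B \ A ∧ b ∈ A \ B)
        then edgeValue x a b else 0) = 0 := by linarith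
  refine Finset.sum_eq_zero fun a _ => Finset.sum_eq_zero fun b _ => ?_
  have h6 := (Finset.sum_eq_zero_iff_of_nonneg fun b _ => hnn a b).mp
    ((Finset.sum_eq_zero_iff_of_nonneg fun a _ => Finset.sum_nonneg fun b _ => hnn a b).mp h5 a
      (Finset.mem_univ a)) b (Finset.mem_univ b)
  split_ifs at h6 ⊢ with h
  · refine edgeValue_of_not_adj z fun hab => ?_
    exact absurd h6 (edgeValue_pos hpos hab).ne'
  · rfl

open Classical in
/-- The cut functionals of a maximal laminar family of tight sets span those of all tight sets. -/
lemma cutValue_eq_zero_of_laminar {x : G.edgeSet → ℝ} (hx : x ∈ feasible G)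
    (hpos : ∀ e, 0 < x e) {r : V} {L : Finset (Finset V)} (hL : ∀ A ∈ L, IsTight x r A)
    (hlam : ∀ A ∈ L, ∀ B ∈ L, ¬ Crossing A B)
    (hmax : ∀ S, IsTight x r S → (∀ A ∈ L, ¬ Crossing S A) → S ∈ L)
    {z : G.edgeSet → ℝ} (hz : ∀ A ∈ L, cutValue G z A = 0) {S : Finset V}
    (hS : IsTight x r S) : cutValue G z S = 0 := by
  -- Induction on the number of members of `L` that `S` crosses: uncrossing with one such member `A`
  -- expresses the cut of `S` by the cuts of `A`, `S ∩ A` and `S ∪ A`.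
  induction hn : (L.filter fun A => Crossing S A).card using Nat.strong_induction_on
    generalizing S with
  | _ n ih =>
    by_cases h : ∀ A ∈ L, ¬ Crossing S A
    · exact hz S (hmax S hS h)
    · push Not at h
      obtain ⟨A, hA, hSA⟩ := h
      obtain ⟨h1, h2, h3⟩ := hS.uncross hx hpos (hL A hA)
        (hSA.1.imp fun v hv => Finset.mem_inter.mpr hv)
      -- A member of `L` does not cross `A`; if it crosses `S ∩ A` or `S ∪ A`, it already crosses
      -- `S`. The member `A` itself is crossed by `S` but by neither of these, so the count drops.
      have hlt : ∀ R : Finset V, ¬ Crossing R A → (∀ B ∈ L, Crossing R B → Crossing S B) →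
          (L.filter fun B => Crossing R B).card < n := by
        intro R hR hRS
        rw [← hn]
        refine Finset.card_lt_card ⟨fun B hB => ?_, fun hsub => ?_⟩
        · rw [Finset.mem_filter] at hB ⊢
          exact ⟨hB.1, hRS B hB.1 hB.2⟩
        · exact hR (Finset.mem_filter.mp (hsub (Finset.mem_filter.mpr ⟨hA, hSA⟩))).2
      have h4 := ih _ (hlt (S ∩ A) (fun h => h.2.1 Finset.inter_subset_right) (by
        intro B hB hc
        have hAB := hlam A hA B hB
        simp only [Crossing, Finset.subset_iff, Finset.mem_inter] at hAB hc hSA ⊢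
        grind)) h1 rfl
      have h5 := ih _ (hlt (S ∪ A) (fun h => h.2.2 Finset.subset_union_right) (by
        intro B hB hc
        have hAB := hlam A hA B hB
        simp only [Crossing, Finset.subset_iff, Finset.mem_union] at hAB hc hSA ⊢
        grind)) h2 rfl
      have h6 := h3 z
      rw [h4, h5, hz A hA] at h6
      linarith

open Classical in
/-- If a vector vanishes on all tight cuts of an extreme point with full support, it is zero. -/
lemma eq_zero_of_cutValue_eq_zero {x : G.edgeSet → ℝ} (hx : x ∈ (feasible G).extremePoints ℝ)
    (hpos : ∀ e, 0 < x e) {z : G.edgeSet → ℝ}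
    (hz : ∀ S : Finset V, S.Nonempty → S ≠ Finset.univ → cutValue G x S = 2 →
      cutValue G z S = 0) : z = 0 := by
  -- Tight constraints stay tight along `z`, and the others, like positivity, have slack. So `x` can
  -- move a little along both `z` and `-z`, which extremality forbids unless `z = 0`.
  have hev : ∀ᶠ t in nhds (0 : ℝ), x + t • z ∈ feasible G := by
    have h1 : ∀ᶠ t in nhds (0 : ℝ), ∀ e, 0 ≤ (x + t • z) e := by
      rw [Filter.eventually_all]
      intro e
      have : Filter.Tendsto (fun t : ℝ => (x + t • z) e) (nhds 0) (nhds (x e)) := by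
        have : Continuous fun t : ℝ => x e + t * z e := by fun_prop
        simpa using this.tendsto 0
      exact (this.eventually (lt_mem_nhds (hpos e))).mono fun t ht => le_of_lt ht
    have h2 : ∀ᶠ t in nhds (0 : ℝ), ∀ S : Finset V, S.Nonempty → S ≠ Finset.univ →
        2 ≤ cutValue G (x + t • z) S := by
      rw [Filter.eventually_all]
      intro S
      by_cases hS : S.Nonempty ∧ S ≠ Finset.univ
      · rcases (hx.1.2 S hS.1 hS.2).eq_or_lt with h | h
        · refine Filter.Eventually.of_forall fun t _ _ => ?_
          rw [cutValue_add_smul, hz S hS.1 hS.2 h.symm, ← h]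
          simp
        · have : Filter.Tendsto (fun t : ℝ => cutValue G (x + t • z) S) (nhds 0)
              (nhds (cutValue G x S)) := by
            simp_rw [cutValue_add_smul]
            have : Continuous fun t : ℝ => cutValue G x S + t * cutValue G z S := by fun_prop
            simpa using this.tendsto 0
          exact (this.eventually (lt_mem_nhds h)).mono fun t ht _ _ => le_of_lt ht
      · exact Filter.Eventually.of_forall fun t h h' => absurd ⟨h, h'⟩ hS
    exact (h1.and h2).mono fun t h => h
  obtain ⟨ε, hε, hball⟩ := Metric.eventually_nhds_iff.mp hev
  have hp : x + (ε / 2) • z ∈ feasible G := hball (by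
    rw [Real.dist_eq, sub_zero, abs_of_pos (by linarith)]; linarith)
  have hm : x + (-(ε / 2)) • z ∈ feasible G := hball (by
    rw [Real.dist_eq, sub_zero, abs_neg, abs_of_pos (by linarith)]; linarith)
  have hseg : x ∈ openSegment ℝ (x + (ε / 2) • z) (x + (-(ε / 2)) • z) :=
    ⟨1 / 2, 1 / 2, by norm_num, by norm_num, by norm_num, by
      ext e
      simp only [Pi.add_apply, Pi.smul_apply, smul_eq_mul]
      ring⟩
  have h := hx.2 hp hm hseg
  have h' : (ε / 2) • z = 0 := by simpa using h
  exact (smul_eq_zero.mp h').resolve_left (by linarith)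

open Classical in
/-- An extreme point of the Held-Karp polytope with full support has at most `2 n - 2` edges. -/
lemma card_edgeSet_le [Nonempty V] {x : G.edgeSet → ℝ}
    (hx : x ∈ (feasible G).extremePoints ℝ) (hpos : ∀ e, 0 < x e) :
    Fintype.card G.edgeSet + 2 ≤ 2 * Fintype.card V := by
  obtain ⟨r⟩ := ‹Nonempty V›
  -- Restricting to sets that avoid one vertex `r` loses no cut, by complementation, and reduces the
  -- ground set of the laminar family to `n - 1` elements.
  obtain ⟨L, hL, hLmax⟩ := Finset.exists_max_image
    (Finset.univ.filter fun L : Finset (Finset V) =>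
      (∀ A ∈ L, IsTight x r A) ∧ ∀ A ∈ L, ∀ B ∈ L, ¬ Crossing A B) Finset.card
    ⟨∅, by simp⟩
  simp only [Finset.mem_filter, Finset.mem_univ, true_and] at hL hLmax
  have hnc : ∀ A : Finset V, ¬ Crossing A A := fun A h => h.2.1 subset_rfl
  have hmax : ∀ S, IsTight x r S → (∀ A ∈ L, ¬ Crossing S A) → S ∈ L := by
    intro S hS hSL
    by_contra hSn
    have := hLmax (insert S L) ⟨by
      intro A hA
      rcases Finset.mem_insert.mp hA with rfl | hA
      exacts [hS, hL.1 A hA], by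
      intro A hA B hB
      rw [Finset.mem_insert] at hA hB
      rcases hA with rfl | hA <;> rcases hB with rfl | hB
      exacts [hnc _, hSL B hB, fun h => hSL A hA h.symm, hL.2 A hA B hB]⟩
    rw [Finset.card_insert_of_notMem hSn] at this
    omega
  have hcard : L.card ≤ 2 * (Finset.univ.erase r).card := by
    refine Finset.card_le_of_laminar _ L (fun A hA => ⟨(hL.1 A hA).1, fun v hv => ?_⟩) ?_
    · exact Finset.mem_erase.mpr ⟨fun h => (hL.1 A hA).2.1 (h ▸ hv), Finset.mem_univ v⟩
    · intro A hA B hB hAB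
      by_contra! h
      exact hL.2 A hA B hB ⟨hAB.imp fun v hv => Finset.mem_inter.mp hv, h.1, h.2⟩
  rw [Finset.card_erase_of_mem (Finset.mem_univ r), Finset.card_univ] at hcard
  have hV : 0 < Fintype.card V := Fintype.card_pos_iff.mpr ⟨r⟩
  suffices h : Fintype.card G.edgeSet ≤ L.card by omega
  -- With more edges than members of `L`, some nonzero vector vanishes on all cuts of `L`, hence on
  -- all tight cuts.
  by_contra! hlt
  let F : (G.edgeSet → ℝ) →ₗ[ℝ] (L → ℝ) :=
    { toFun := fun z A => cutValue G z A
      map_add' := fun y z => by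
        ext A
        simpa using cutValue_add_smul y z 1 A
      map_smul' := fun t z => by
        ext A
        simp [cutValue, Finset.mul_sum] }
  have hker := F.ker_ne_bot_of_finrank_lt (by simpa using hlt)
  obtain ⟨z, hz, hz0⟩ := (Submodule.ne_bot_iff _).mp hker
  have hzL : ∀ A ∈ L, cutValue G z A = 0 := fun A hA => congrFun (LinearMap.mem_ker.mp hz) ⟨A, hA⟩
  refine hz0 (eq_zero_of_cutValue_eq_zero hx hpos fun S hS1 hS2 hS3 => ?_)
  by_cases hr : r ∈ S
  · have hS : IsTight x r Sᶜ := by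
      refine ⟨?_, by simpa using hr, by rw [cutValue_compl, hS3]⟩
      rwa [Finset.nonempty_iff_ne_empty, Ne, Finset.compl_eq_empty_iff]
    rw [← cutValue_compl]
    exact cutValue_eq_zero_of_laminar hx.1 hpos hL.1 hL.2 hmax hzL hS
  · exact cutValue_eq_zero_of_laminar hx.1 hpos hL.1 hL.2 hmax hzL (S := S) ⟨hS1, hr, hS3⟩

lemma objective_eq_optLP {x : G.edgeSet → ℝ} (hx : IsExtremeOptimal G x) :
    objective G x = optLP G := by
  have h : IsLeast (objective G '' feasible G) (objective G x) := by
    refine ⟨⟨x, hx.1.1, rfl⟩, ?_⟩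
    rintro _ ⟨y, hy, rfl⟩
    exact hx.2 hy
  exact h.csInf_eq.symm

end HeldKarp

/-! ### The network: directed paths of tree-arcs and flows along cycles. -/

namespace DFSTree

variable {V : Type*} {G : SimpleGraph V} {T : DFSTree G}

/-- A height function on the network that increases along tree-arcs. -/
def level (T : DFSTree G) : T.Node → ℕ
  | Sum.inl v => 2 * T.disc v + 1
  | Sum.inr w => 2 * T.disc w

lemma TreeArc.level_lt {c d : T.Node} (h : T.TreeArc c d) : T.level c < T.level d := by
  cases h with
  | fromRoot w hw h =>
    have := T.disc_parent_lt w hw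
    rw [h] at this
    simp only [level]; omega
  | upper w =>
    have := T.disc_parent_lt w w.2.1
    simp only [level]; omega
  | lower w => simp only [level]; omega

open Classical in
/-- The tail of the tree-arc that enters a vertex of the network. -/
noncomputable def pred (T : DFSTree G) : T.Node → T.Node
  -- The default branch is meant for the children of the root. The root falls into it too,
  -- harmlessly, since no tree-arc enters the root.
  | Sum.inl w => if h : w ≠ T.root ∧ T.parent w ≠ T.root then Sum.inr ⟨w, h⟩ else Sum.inl T.root
  | Sum.inr w => Sum.inl (T.parent w)

lemma TreeArc.eq_pred {c d : T.Node} (h : T.TreeArc c d) : c = T.pred d := by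
  cases h with
  | fromRoot w hw h => simp [pred, h]
  | upper w => rfl
  | lower w => simp [pred, w.2.1, w.2.2]

lemma TreeArc.left_unique {c c' d : T.Node} (h : T.TreeArc c d) (h' : T.TreeArc c' d) : c = c' :=
  h.eq_pred.trans h'.eq_pred.symm

lemma Reach.level_le {c d : T.Node} (h : T.Reach c d) : T.level c ≤ T.level d := by
  induction h with
  | refl => exact le_rfl
  | tail _ h ih => exact ih.trans h.level_lt.le

lemma Reach.refl (c : T.Node) : T.Reach c c := Relation.ReflTransGen.refl

lemma Reach.trans {a b c : T.Node} (h : T.Reach a b) (h' : T.Reach b c) : T.Reach a c :=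
  Relation.ReflTransGen.trans h h'

lemma TreeArc.reach {c d : T.Node} (h : T.TreeArc c d) : T.Reach c d :=
  Relation.ReflTransGen.single h

lemma Reach.pred_right {q c d : T.Node} (h : T.Reach q d) (hne : q ≠ d) (hcd : T.TreeArc c d) :
    T.Reach q c := by
  rcases Relation.ReflTransGen.cases_tail h with rfl | ⟨e, he, h1⟩
  · exact absurd rfl hne
  · rwa [hcd.left_unique h1]

lemma Reach.total {a b c : T.Node} (h : T.Reach a c) (h' : T.Reach b c) :
    T.Reach a b ∨ T.Reach b a := by
  induction h' with
  | refl => exact Or.inl h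
  | tail hb hc ih =>
    rename_i d e
    by_cases hae : a = e
    · subst hae
      exact Or.inr (hb.tail hc)
    · exact ih (h.pred_right hae hc)

/-- Two heads above the same `p` are comparable; if they differed, one would reach the tail `c` of
the arc into the other, against the levels. Thus a cycle leaves each of its vertices along one arc.
-/
lemma TreeArc.right_unique {c d d' p : T.Node} (h : T.TreeArc c d) (h' : T.TreeArc c d')
    (hd : T.Reach d p) (hd' : T.Reach d' p) : d = d' := by
  by_contra hne
  rcases hd.total hd' with h1 | h1
  · exact absurd (h1.pred_right hne h').level_le (not_le.mpr h.level_lt)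
  · exact absurd (h1.pred_right (Ne.symm hne) h).level_le (not_le.mpr h'.level_lt)

lemma IsAncestor.reach {a b : V} (h : T.IsAncestor a b) : T.Reach (Sum.inl a) (Sum.inl b) := by
  induction h with
  | refl => exact .refl _
  | @tail c d _ h ih =>
    obtain ⟨h1, rfl⟩ := h
    by_cases h2 : T.parent d = T.root
    · rw [h2] at ih
      exact ih.tail (.fromRoot d h1 h2)
    · exact (ih.tail (.upper ⟨d, h1, h2⟩)).tail (.lower ⟨d, h1, h2⟩)

lemma BackArc.reach {p q : T.Node} (h : T.BackArc p q) : T.Reach q p := by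
  cases h with
  | toRoot u h hu => exact (T.root_isAncestor u).reach
  | toNew u w h hu hwu => exact (TreeArc.lower w).reach.trans hwu.reach

lemma BackArc.not_treeArc {p q : T.Node} (h : T.BackArc p q) : ¬ T.TreeArc p q := fun h' =>
  absurd h.reach.level_le (not_le.mpr h'.level_lt)

lemma cycleFlow_nonneg (p q c d : T.Node) : 0 ≤ T.cycleFlow p q c d := by
  unfold cycleFlow
  split_ifs
  exacts [zero_le_one, le_rfl]

lemma cycleFlow_of_backArc {p q c d : T.Node} (hcd : T.BackArc c d) [Decidable (c = p ∧ d = q)] :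
    T.cycleFlow p q c d = if c = p ∧ d = q then 1 else 0 := by
  unfold cycleFlow
  simp [hcd.not_treeArc]

lemma min_edgeValue_nonneg {x : G.edgeSet → ℝ} (hx : ∀ e, 0 ≤ x e) (a b : V) :
    0 ≤ min (edgeValue x a b) 1 := le_min (HeldKarp.edgeValue_nonneg hx a b) zero_le_one

lemma not_isIn_parent (w : {w : V // w ≠ T.root ∧ T.parent w ≠ T.root}) :
    ¬ T.IsIn (Sum.inl (T.parent w)) := w.2.2

/-- An edge from the subtree of `w` to a strict ancestor of the parent of `w` is a back-arc. -/
lemma exists_backArc_of_adj {w : {w : V // w ≠ T.root ∧ T.parent w ≠ T.root}} {a t : V}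
    (ha : T.IsAncestor w a) (ht : T.IsAncestor t (T.parent w)) (hne : t ≠ T.parent w)
    (hat : G.Adj a t) :
    ∃ q, T.BackArc (Sum.inl a) q ∧ T.base q = t ∧ T.Reach q (Sum.inl (T.parent w)) := by
  by_cases htr : t = T.root
  · subst htr
    refine ⟨Sum.inl T.root, .toRoot a hat fun hpa => ?_, rfl, (T.root_isAncestor _).reach⟩
    by_cases hwa : (w : V) = a
    · exact w.2.2 (hwa ▸ hpa)
    · have h := (ha.parent_right hwa).2
      rw [hpa] at h
      exact w.2.1 (eq_of_isAncestor_root h)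
  · obtain ⟨c, hc, rfl, hcw⟩ := ht.exists_child hne
    refine ⟨Sum.inr ⟨c, hc, htr⟩, .toNew a ⟨c, hc, htr⟩ hat ?_
      ((hcw.trans (isAncestor_parent w.2.1)).trans ha), rfl,
      (TreeArc.lower ⟨c, hc, htr⟩).reach.trans hcw.reach⟩
    rintro rfl
    have h1 := hcw.disc_le
    have h2 := ha.disc_le
    have h3 := T.disc_parent_lt w w.2.1
    omega

lemma exists_upper {v w : T.Node} (hv : ¬ T.IsIn v) (hw : T.IsIn w) (h : T.TreeArc v w) :
    ∃ w' : {w : V // w ≠ T.root ∧ T.parent w ≠ T.root},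
      v = Sum.inl (T.parent w') ∧ w = Sum.inr w' := by
  cases h with
  | fromRoot w hw h => exact absurd rfl hv
  | upper w => exact ⟨w, rfl, rfl⟩
  | lower w => exact absurd trivial hv

lemma isIn_inr (w : {w : V // w ≠ T.root ∧ T.parent w ≠ T.root}) :
    T.IsIn (Sum.inr w) := trivial

variable [Fintype V]

open Classical in
-- The cycle passes once through exactly the vertices between `q` and `p`. The sum over outgoing
-- arcs has the same value, which gives conservation.
lemma sum_cycleFlow_left {p q : T.Node} (h : T.BackArc p q) (c : T.Node) :
    ∑ d, T.cycleFlow p q d c = if T.Reach q c ∧ T.Reach c p then 1 else 0 := by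
  unfold cycleFlow
  by_cases hc : c = q
  · subst hc
    rw [if_pos ⟨.refl c, h.reach⟩, Finset.sum_eq_single p]
    · simp
    · intro d _ hd
      rw [if_neg]
      rintro (⟨h1, -⟩ | ⟨h1, h2, -⟩)
      · exact hd h1
      · exact absurd h2.level_le (not_le.mpr h1.level_lt)
    · simp
  · by_cases hr : T.Reach q c ∧ T.Reach c p
    · rw [if_pos hr]
      rcases Relation.ReflTransGen.cases_tail hr.1 with h1 | ⟨e, he, h1⟩
      · exact absurd h1 hc
      rw [Finset.sum_eq_single e]
      · rw [if_pos (Or.inr ⟨h1, he, hr.2⟩)]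
      · intro d _ hd
        rw [if_neg]
        rintro (⟨-, h2⟩ | ⟨h2, -, -⟩)
        exacts [hc h2, hd (h2.left_unique h1)]
      · simp
    · rw [if_neg hr]
      refine Finset.sum_eq_zero fun d _ => if_neg ?_
      rintro (⟨-, h2⟩ | ⟨h1, h2, h3⟩)
      exacts [hc h2, hr ⟨h2.tail h1, h3⟩]

open Classical in
lemma sum_cycleFlow_right {p q : T.Node} (h : T.BackArc p q) (c : T.Node) :
    ∑ d, T.cycleFlow p q c d = if T.Reach q c ∧ T.Reach c p then 1 else 0 := by
  unfold cycleFlow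
  by_cases hc : c = p
  · subst hc
    rw [if_pos ⟨h.reach, .refl c⟩, Finset.sum_eq_single q]
    · simp
    · intro d _ hd
      rw [if_neg]
      rintro (⟨-, h1⟩ | ⟨h1, -, h2⟩)
      · exact hd h1
      · exact absurd h2.level_le (not_le.mpr h1.level_lt)
    · simp
  · by_cases hr : T.Reach q c ∧ T.Reach c p
    · rw [if_pos hr]
      rcases Relation.ReflTransGen.cases_head hr.2 with h1 | ⟨e, h1, he⟩
      · exact absurd h1 hc
      rw [Finset.sum_eq_single e]
      · rw [if_pos (Or.inr ⟨h1, hr.1, he⟩)]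
      · intro d _ hd
        rw [if_neg]
        rintro (⟨h2, -⟩ | ⟨h2, -, h3⟩)
        exacts [hc h2, hd (h2.right_unique h1 h3 he)]
      · simp
    · rw [if_neg hr]
      refine Finset.sum_eq_zero fun d _ => if_neg ?_
      rintro (⟨h2, -⟩ | ⟨h1, h2, h3⟩)
      exacts [hc h2, hr ⟨h2, h1.reach.trans h3⟩]

open Classical in
/-- A nonnegative conserved flow on the arcs of the network. -/
def IsFlow (T : DFSTree G) (f : T.Node → T.Node → ℝ) : Prop :=
  (∀ c d, 0 ≤ f c d) ∧
  (∀ c d, ¬ T.TreeArc c d → ¬ T.BackArc c d → f c d = 0) ∧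
  (∀ c, ∑ d, f d c = ∑ d, f c d)

lemma IsFlow.zero : T.IsFlow 0 := by simp [IsFlow]

lemma IsFlow.add {f g : T.Node → T.Node → ℝ} (hf : T.IsFlow f) (hg : T.IsFlow g) :
    T.IsFlow (f + g) :=
  ⟨fun c d => add_nonneg (hf.1 c d) (hg.1 c d),
    fun c d h h' => by simp [hf.2.1 c d h h', hg.2.1 c d h h'],
    fun c => by simp only [Pi.add_apply, Finset.sum_add_distrib, hf.2.2 c, hg.2.2 c]⟩

lemma IsFlow.smul_cycleFlow {p q : T.Node} (h : T.BackArc p q) {t : ℝ} (ht : 0 ≤ t) :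
    T.IsFlow (t • T.cycleFlow p q) := by
  refine ⟨fun c d => mul_nonneg ht (cycleFlow_nonneg p q c d), fun c d h1 h2 => ?_, fun c => ?_⟩
  · have : T.cycleFlow p q c d = 0 := by
      refine if_neg ?_
      rintro (⟨rfl, rfl⟩ | ⟨h3, -⟩)
      exacts [h2 h, h1 h3]
    simp [this]
  · simp only [Pi.smul_apply, smul_eq_mul, ← Finset.mul_sum, sum_cycleFlow_left h,
      sum_cycleFlow_right h]

lemma IsFlow.sum {ι : Type*} (s : Finset ι) {f : ι → T.Node → T.Node → ℝ}
    (hf : ∀ i ∈ s, T.IsFlow (f i)) : T.IsFlow (∑ i ∈ s, f i) := by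
  classical
  induction s using Finset.induction_on with
  | empty => simpa using IsFlow.zero
  | insert a s ha ih =>
    rw [Finset.sum_insert ha]
    exact (hf a (Finset.mem_insert_self a s)).add
      (ih fun i hi => hf i (Finset.mem_insert_of_mem hi))

open Classical in
lemma coreFlow_eq_sum (x : G.edgeSet → ℝ) : T.coreFlow x =
    ∑ a : T.Node × T.Node with T.BackArc a.1 a.2,
      min (edgeValue x (T.base a.1) (T.base a.2)) 1 • T.cycleFlow a.1 a.2 := by
  ext c d
  simp [coreFlow, Finset.sum_apply]

lemma isFlow_coreFlow {x : G.edgeSet → ℝ} (hx : ∀ e, 0 ≤ x e) : T.IsFlow (T.coreFlow x) := by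
  classical
  rw [coreFlow_eq_sum]
  exact IsFlow.sum _ fun a ha =>
    .smul_cycleFlow (Finset.mem_filter.mp ha).2 (min_edgeValue_nonneg hx _ _)

/-! ### Cost and deficit during the correction. -/

/-- The flow on the arc that goes from the parent of `w` to the new vertex above `w`. -/
def upperFlow (f : T.Node → T.Node → ℝ) (w : {w : V // w ≠ T.root ∧ T.parent w ≠ T.root}) : ℝ :=
  f (Sum.inl (T.parent w)) (Sum.inr w)

open Classical in
/-- The total amount by which the arcs from out-vertices to in-vertices fall short of `1`. -/
noncomputable def deficit (f : T.Node → T.Node → ℝ) : ℝ :=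
  ∑ w : {w : V // w ≠ T.root ∧ T.parent w ≠ T.root}, max (1 - upperFlow f w) 0

lemma deficit_nonneg (f : T.Node → T.Node → ℝ) : 0 ≤ deficit f :=
  Finset.sum_nonneg fun _ _ => le_max_right _ _

open Classical in
lemma backInflow_add_smul_cycleFlow (f : T.Node → T.Node → ℝ) {p q : T.Node}
    (h : T.BackArc p q) (t : ℝ) (v : T.Node) :
    T.backInflow (f + t • T.cycleFlow p q) v = T.backInflow f v + if v = q then t else 0 := by
  unfold backInflow
  simp only [Pi.add_apply, Pi.smul_apply, smul_eq_mul, Finset.sum_add_distrib, add_right_inj]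
  by_cases hv : v = q
  · subst hv
    rw [if_pos rfl, Finset.sum_eq_single p]
    · rw [cycleFlow_of_backArc h, if_pos ⟨rfl, rfl⟩, mul_one]
    · intro p' hp' hne
      rw [cycleFlow_of_backArc (Finset.mem_filter.mp hp').2, if_neg (fun h => hne h.1), mul_zero]
    · intro hp
      exact absurd (Finset.mem_filter.mpr ⟨Finset.mem_univ p, h⟩) hp
  · rw [if_neg hv]
    refine Finset.sum_eq_zero fun p' hp' => ?_
    rw [cycleFlow_of_backArc (Finset.mem_filter.mp hp').2, if_neg (fun h => hv h.2), mul_zero]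

/-- A cycle contains a single back-arc, so only the inflow of `q` grows. -/
lemma cost_add_smul_cycleFlow_le (f : T.Node → T.Node → ℝ) {p q : T.Node}
    (h : T.BackArc p q) {t : ℝ} (ht : 0 ≤ t) :
    T.cost (f + t • T.cycleFlow p q) ≤ T.cost f + t := by
  classical
  unfold cost
  simp only [backInflow_add_smul_cycleFlow f h]
  calc _ ≤ ∑ v : T.Node with T.IsIn v, (max (T.backInflow f v - 1) 0 + if v = q then t else 0) := by
        refine Finset.sum_le_sum fun v _ => ?_
        split_ifs
        · exact max_le (by linarith [le_max_left (T.backInflow f v - 1) 0])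
            (by linarith [le_max_right (T.backInflow f v - 1) 0])
        · simp
    _ ≤ _ := by
        rw [Finset.sum_add_distrib, Finset.sum_ite_eq']
        split_ifs <;> linarith

lemma deficit_add_smul_cycleFlow_le (f : T.Node → T.Node → ℝ) {p q : T.Node}
    {w : {w : V // w ≠ T.root ∧ T.parent w ≠ T.root}} (hlt : upperFlow f w < 1)
    (hp : T.Reach (Sum.inr w) p) (hq : T.Reach q (Sum.inl (T.parent w))) :
    (∀ w', upperFlow f w' ≤
      upperFlow (f + (1 - upperFlow f w) • T.cycleFlow p q) w') ∧
    upperFlow (f + (1 - upperFlow f w) • T.cycleFlow p q) w = 1 ∧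
    deficit (f + (1 - upperFlow f w) • T.cycleFlow p q) + (1 - upperFlow f w) ≤ deficit f := by
  classical
  have h1 : ∀ w', upperFlow f w' ≤ upperFlow (f + (1 - upperFlow f w) • T.cycleFlow p q) w' :=
    fun w' => le_add_of_nonneg_right (mul_nonneg (by linarith) (cycleFlow_nonneg _ _ _ _))
  have h2 : upperFlow (f + (1 - upperFlow f w) • T.cycleFlow p q) w = 1 := by
    have : T.cycleFlow p q (Sum.inl (T.parent w)) (Sum.inr w) = 1 :=
      if_pos (Or.inr ⟨.upper w, hq, hp⟩)
    change upperFlow f w + (1 - upperFlow f w) * _ = 1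
    rw [this]; ring
  refine ⟨h1, h2, ?_⟩
  have h3 : (1 - upperFlow f w) = ∑ w', if w' = w then 1 - upperFlow f w else 0 := by simp
  unfold deficit
  rw [h3, ← Finset.sum_add_distrib, ← h3]
  refine Finset.sum_le_sum fun w' _ => ?_
  split_ifs with h
  · subst h
    rw [h2, sub_self, max_self, zero_add]
    exact le_max_left _ _
  · rw [add_zero]
    exact max_le_max (by linarith [h1 w']) le_rfl

/-- Cost plus deficit is a potential that no push increases. -/
lemma PartialCorrection.isFlow_and_cost_le {x : G.edgeSet → ℝ} {g : T.Node → T.Node → ℝ}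
    (hg : T.PartialCorrection x g) : T.IsFlow g ∧
      T.cost (T.coreFlow x + g) + deficit (T.coreFlow x + g) ≤
        T.cost (T.coreFlow x) + deficit (T.coreFlow x) := by
  induction hg with
  | zero => exact ⟨.zero, by rw [add_zero]⟩
  | push g v w p q hg hv hw hvw hlt hpq hp hq ih =>
    obtain ⟨w', rfl, rfl⟩ := exists_upper hv hw hvw
    refine ⟨ih.1.add (.smul_cycleFlow hpq (by linarith)), ?_⟩
    rw [← add_assoc]
    have h1 := cost_add_smul_cycleFlow_le (T.coreFlow x + g) hpq (sub_nonneg.mpr hlt.le)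
    have h2 := (deficit_add_smul_cycleFlow_le (T.coreFlow x + g) hlt hp hq).2.2
    unfold upperFlow at h2
    linarith [ih.2]

lemma exists_backArc_above (hG : TwoVertexConnected G)
    (w : {w : V // w ≠ T.root ∧ T.parent w ≠ T.root}) :
    ∃ p q, T.BackArc p q ∧ T.Reach (Sum.inr w) p ∧ T.Reach q (Sum.inl (T.parent w)) := by
  obtain ⟨a, t, ha, hne, ht, hat⟩ := exists_adj_above hG w.2.1 w.2.2
  obtain ⟨q, h1, -, h2⟩ := exists_backArc_of_adj ha ht hne hat
  exact ⟨_, q, h1, (TreeArc.lower w).reach.trans ha.reach, h2⟩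

lemma exists_isCorrection (hG : TwoVertexConnected G) (x : G.edgeSet → ℝ) :
    ∃ g, T.IsCorrection x g := by
  classical
  -- The number of arcs short of one unit decreases with every push: the chosen arc is completed and
  -- no arc loses flow.
  suffices H : ∀ n g, T.PartialCorrection x g →
      (Finset.univ.filter fun w => upperFlow (T.coreFlow x + g) w < 1).card = n →
      ∃ g, T.IsCorrection x g from H _ 0 .zero rfl
  intro n
  induction n using Nat.strong_induction_on with
  | _ n ih =>
    rintro g hg rfl
    by_cases h : ∃ w, upperFlow (T.coreFlow x + g) w < 1
    · obtain ⟨w, hw⟩ := h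
      obtain ⟨p, q, hpq, hp, hq⟩ := exists_backArc_above hG w
      have hd := deficit_add_smul_cycleFlow_le (T.coreFlow x + g) hw hp hq
      refine ih _ ?_ _ (hg.push g _ _ p q (not_isIn_parent w) (isIn_inr w) (.upper w) hw hpq hp hq) rfl
      rw [← add_assoc]
      refine Finset.card_lt_card ⟨fun w' hw' => ?_, fun hsub => ?_⟩
      · rw [Finset.mem_filter] at hw' ⊢
        exact ⟨hw'.1, (hd.1 w').trans_lt hw'.2⟩
      · have := (Finset.mem_filter.mp (hsub (Finset.mem_filter.mpr ⟨Finset.mem_univ w, hw⟩))).2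
        exact absurd hd.2.1 this.ne
    · push Not at h
      refine ⟨g, hg, fun v w hv hw hvw => ?_⟩
      obtain ⟨w', rfl, rfl⟩ := exists_upper hv hw hvw
      exact h w'

/-- The demands on the remaining tree-arcs follow from conservation. A new vertex has a single
outgoing arc, and the child of the root has a single incoming arc and, since `n ≥ 3`, a child of its
own that draws a unit. -/
lemma isCirculation_of_isFlow (hG : TwoVertexConnected G) {f : T.Node → T.Node → ℝ}
    (hf : T.IsFlow f)
    (h : ∀ w : {w : V // w ≠ T.root ∧ T.parent w ≠ T.root},
      1 ≤ f (Sum.inl (T.parent w)) (Sum.inr w)) : T.IsCirculation f := by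
  classical
  refine ⟨hf.1, hf.2.1, hf.2.2, fun c d hcd => ?_⟩
  cases hcd with
  | upper w => exact h w
  | lower w =>
    have h1 := hf.2.2 (Sum.inr w)
    have h2 : ∑ d, f (Sum.inr w) d = f (Sum.inr w) (Sum.inl w) := by
      refine Finset.sum_eq_single _ (fun d _ hd => hf.2.1 _ _ ?_ ?_) (by simp)
      · intro h3
        cases h3
        exact hd rfl
      · intro h3
        cases h3
    have h3 := Finset.single_le_sum (f := fun d => f d (Sum.inr w)) (fun d _ => hf.1 d _)
      (Finset.mem_univ (Sum.inl (T.parent w)))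
    have h4 := h w
    linarith
  | fromRoot w hw hpw =>
    have h1 := hf.2.2 (Sum.inl w)
    have h2 : ∑ d, f d (Sum.inl w) = f (Sum.inl T.root) (Sum.inl w) := by
      refine Finset.sum_eq_single _ (fun d _ hd => hf.2.1 _ _ ?_ ?_) (by simp)
      · intro h3
        exact hd (h3.left_unique (.fromRoot w hw hpw))
      · intro h3
        generalize hq : (Sum.inl w : T.Node) = q at h3
        cases h3
        · exact hw (Sum.inl.inj hq)
        · cases hq
    obtain ⟨c, hc, rfl⟩ := exists_grandchild_root hG hw hpw
    have h3 := Finset.single_le_sum (f := fun d => f (Sum.inl (T.parent c)) d)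
      (fun d _ => hf.1 _ d) (Finset.mem_univ (Sum.inr ⟨c, hc, hw⟩))
    have h4 := h ⟨c, hc, hw⟩
    linarith

lemma IsCorrection.isCirculation (hG : TwoVertexConnected G) {x : G.edgeSet → ℝ}
    (hx : ∀ e, 0 ≤ x e) {g : T.Node → T.Node → ℝ} (hg : T.IsCorrection x g) :
    T.IsCirculation (T.coreFlow x + g) :=
  isCirculation_of_isFlow hG ((isFlow_coreFlow hx).add hg.1.isFlow_and_cost_le.1) fun w =>
    hg.2 _ _ (not_isIn_parent w) (isIn_inr w) (.upper w)

lemma IsCorrection.cost_le {x : G.edgeSet → ℝ} {g : T.Node → T.Node → ℝ}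
    (hg : T.IsCorrection x g) :
    T.cost (T.coreFlow x + g) ≤ T.cost (T.coreFlow x) + deficit (T.coreFlow x) :=
  (le_add_of_nonneg_right (deficit_nonneg _)).trans hg.1.isFlow_and_cost_le.2

end DFSTree

/-! ### The core flow in terms of LP values of edges at a subtree. -/

lemma Finset.min_sum_one_le {ι : Type*} (s : Finset ι) {f : ι → ℝ} (hf : ∀ i ∈ s, 0 ≤ f i) :
    min (∑ i ∈ s, f i) 1 ≤ ∑ i ∈ s, min (f i) 1 := by
  classical
  induction s using Finset.induction_on with
  | empty => simp
  | insert a s ha ih =>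
    rw [Finset.sum_insert ha, Finset.sum_insert ha]
    have h1 := ih fun i hi => hf i (Finset.mem_insert_of_mem hi)
    have h2 := hf a (Finset.mem_insert_self a s)
    have h3 := Finset.sum_nonneg fun i hi => hf i (Finset.mem_insert_of_mem hi)
    rcases le_total (f a) 1 with h | h
    · rw [min_eq_left h]
      rcases le_total (∑ i ∈ s, f i) 1 with h' | h'
      · rw [min_eq_left h'] at h1
        exact (min_le_left _ _).trans (by linarith)
      · rw [min_eq_right h'] at h1
        exact (min_le_right _ _).trans (by linarith)
    · rw [min_eq_right h]
      have h4 : 0 ≤ min (∑ i ∈ s, f i) 1 := le_min h3 zero_le_one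
      exact (min_le_right _ _).trans (by linarith)

namespace DFSTree

open HeldKarp

variable {V : Type*} {G : SimpleGraph V} [Fintype V] {T : DFSTree G}

open Classical in
/-- The set of vertices of the subtree rooted at `w`. -/
noncomputable def subtree (T : DFSTree G) (w : V) : Finset V :=
  Finset.univ.filter fun a => T.IsAncestor w a

open Classical in
/-- The tails of the back-arcs from the subtree of `w` to the parent of `w`. -/
noncomputable def backTails (T : DFSTree G) (w : V) : Finset V :=
  Finset.univ.filter fun a => T.IsAncestor w a ∧ a ≠ w ∧ G.Adj a (T.parent w)

open Classical in
/-- The children of `v` in the tree. -/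
noncomputable def children (T : DFSTree G) (v : V) : Finset V :=
  Finset.univ.filter fun w => w ≠ T.root ∧ T.parent w = v

/-- The core flow on the back-arcs from the subtree of `w` to the parent of `w`. -/
noncomputable def coreInflow (T : DFSTree G) (x : G.edgeSet → ℝ) (w : V) : ℝ :=
  ∑ a ∈ T.backTails w, min (edgeValue x a (T.parent w)) 1

/-- The value of the edges between the subtree of `w` and the parent of `w`. -/
noncomputable def parentValue (T : DFSTree G) (x : G.edgeSet → ℝ) (w : V) : ℝ :=
  ∑ a ∈ T.subtree w, edgeValue x a (T.parent w)

open Classical in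
/-- The value of the edges that leave the subtree of `w` and avoid the parent of `w`. -/
noncomputable def aboveValue (T : DFSTree G) (x : G.edgeSet → ℝ) (w : V) : ℝ :=
  ∑ a ∈ T.subtree w, ∑ t ∈ (T.subtree w)ᶜ.erase (T.parent w), edgeValue x a t

lemma mem_subtree {w a : V} : a ∈ T.subtree w ↔ T.IsAncestor w a := by simp [subtree]

lemma mem_backTails {w a : V} :
    a ∈ T.backTails w ↔ T.IsAncestor w a ∧ a ≠ w ∧ G.Adj a (T.parent w) := by simp [backTails]

lemma mem_children {v w : V} : w ∈ T.children v ↔ w ≠ T.root ∧ T.parent w = v := by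
  simp [children]

lemma parentValue_nonneg {x : G.edgeSet → ℝ} (hx : ∀ e, 0 ≤ x e) (w : V) :
    0 ≤ T.parentValue x w := Finset.sum_nonneg fun _ _ => edgeValue_nonneg hx _ _

lemma aboveValue_nonneg {x : G.edgeSet → ℝ} (hx : ∀ e, 0 ≤ x e) (w : V) :
    0 ≤ T.aboveValue x w :=
  Finset.sum_nonneg fun _ _ => Finset.sum_nonneg fun _ _ => edgeValue_nonneg hx _ _

lemma cutValue_subtree (x : G.edgeSet → ℝ) {w : V} (hw : w ≠ T.root) :
    cutValue G x (T.subtree w) = T.parentValue x w + T.aboveValue x w := by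
  classical
  rw [cutValue_eq, parentValue, aboveValue, ← Finset.sum_add_distrib]
  refine Finset.sum_congr (by congr!) fun a _ => ?_
  rw [Finset.add_sum_erase _ (edgeValue x a)
    (by rw [Finset.mem_compl, mem_subtree]; exact not_isAncestor_parent hw)]

lemma two_le_parentValue_add_aboveValue {x : G.edgeSet → ℝ} (hx : x ∈ feasible G) {w : V}
    (hw : w ≠ T.root) : 2 ≤ T.parentValue x w + T.aboveValue x w := by
  rw [← cutValue_subtree x hw]
  refine hx.2 _ ⟨w, mem_subtree.mpr (.refl T w)⟩ fun h => ?_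
  exact hw (eq_of_isAncestor_root (mem_subtree.mp (h ▸ Finset.mem_univ T.root)))

lemma coreInflow_add_le_parentValue {x : G.edgeSet → ℝ} (hx : ∀ e, 0 ≤ x e) (w : V) :
    min (edgeValue x (T.parent w) w) 1 + T.coreInflow x w ≤ T.parentValue x w := by
  classical
  have h1 : w ∉ T.backTails w := fun h => (mem_backTails.mp h).2.1 rfl
  rw [edgeValue_comm, coreInflow, ← Finset.sum_insert
    (f := fun a => min (edgeValue x a (T.parent w)) 1) h1]
  refine (Finset.sum_le_sum fun a _ => min_le_left _ _).trans
    (Finset.sum_le_sum_of_subset_of_nonneg ?_ fun a _ _ => edgeValue_nonneg hx _ _)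
  intro a ha
  rcases Finset.mem_insert.mp ha with rfl | ha
  exacts [mem_subtree.mpr (.refl T _), mem_subtree.mpr (mem_backTails.mp ha).1]

/-- The only use of the search rule: when `w` was discovered, the tails of these back-arcs were
still undiscovered, so none of the edges is heavier than the tree edge. -/
lemma coreInflow_le {x : G.edgeSet → ℝ} (hT : T.FollowsHighest x) {w : V} (hw : w ≠ T.root) :
    T.coreInflow x w ≤ (T.backTails w).card * min (edgeValue x (T.parent w) w) 1 := by
  rw [← nsmul_eq_mul]
  refine Finset.sum_le_card_nsmul _ _ _ fun a ha => min_le_min ?_ le_rfl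
  obtain ⟨h1, -, h2⟩ := mem_backTails.mp ha
  rw [edgeValue_comm]
  exact hT w hw a h2.symm h1.disc_le

open Classical in
lemma pairwiseDisjoint_subtree {v : V} {A : Finset V} (hA : A ⊆ T.children v) :
    (A : Set V).PairwiseDisjoint T.subtree := by
  intro w hw w' hw' hne
  obtain ⟨h1, h2⟩ := mem_children.mp (hA hw)
  obtain ⟨h3, h4⟩ := mem_children.mp (hA hw')
  refine Finset.disjoint_left.mpr fun a ha ha' => hne ?_
  exact eq_of_isAncestor_of_parent_eq h1 h3 (h2.trans h4.symm) (mem_subtree.mp ha)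
    (mem_subtree.mp ha')

open Classical in
lemma sum_parentValue (x : G.edgeSet → ℝ) {v : V} {A : Finset V} (hA : A ⊆ T.children v) :
    ∑ w ∈ A, T.parentValue x w = ∑ b ∈ A.biUnion T.subtree, edgeValue x v b := by
  rw [Finset.sum_biUnion (pairwiseDisjoint_subtree hA)]
  refine Finset.sum_congr rfl fun w hw => Finset.sum_congr rfl fun a _ => ?_
  rw [(mem_children.mp (hA hw)).2, edgeValue_comm]

lemma sum_parentValue_le {x : G.edgeSet → ℝ} (hx : ∀ e, 0 ≤ x e) (v : V) :
    ∑ w ∈ T.children v, T.parentValue x w ≤ cutValue G x {v} := by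
  classical
  rw [sum_parentValue x subset_rfl, cutValue_singleton]
  exact Finset.sum_le_sum_of_subset_of_nonneg (Finset.subset_univ _)
    fun a _ _ => edgeValue_nonneg hx _ _

/-- The cut of `v` together with some of the subtrees below `v`. -/
lemma sum_parentValue_sub_aboveValue_le {x : G.edgeSet → ℝ} (hx : x ∈ feasible G) {v : V}
    (hv : v ≠ T.root) {A : Finset V} (hA : A ⊆ T.children v) :
    ∑ w ∈ A, (T.parentValue x w - T.aboveValue x w) ≤ cutValue G x {v} - 2 := by
  classical
  set B := A.biUnion T.subtree with hB
  have hmem : ∀ a ∈ B, ∃ w ∈ A, T.IsAncestor w a := by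
    intro a ha
    obtain ⟨w, hw, ha⟩ := Finset.mem_biUnion.mp ha
    exact ⟨w, hw, mem_subtree.mp ha⟩
  have hvB : v ∉ B := by
    intro h
    obtain ⟨w, hw, ha⟩ := hmem v h
    obtain ⟨h1, rfl⟩ := mem_children.mp (hA hw)
    exact not_isAncestor_parent h1 ha
  have hrB : T.root ∉ insert v B := by
    intro h
    rcases Finset.mem_insert.mp h with h | h
    · exact hv h.symm
    · obtain ⟨w, hw, ha⟩ := hmem _ h
      exact (mem_children.mp (hA hw)).1 (eq_of_isAncestor_root ha)
  -- Adding the chosen subtrees to `{v}` removes from its cut the edges counted by `parentValue` and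
  -- adds at most those counted by `aboveValue`; the enlarged cut still has value at least 2.
  have h1 := hx.2 (insert v B) (Finset.insert_nonempty v B)
    fun h => hrB (h ▸ Finset.mem_univ T.root)
  have h2 : cutValue G x (insert v B) = ∑ b ∈ (insert v B)ᶜ, edgeValue x v b +
      ∑ w ∈ A, ∑ a ∈ T.subtree w, ∑ b ∈ (insert v B)ᶜ, edgeValue x a b := by
    rw [← Finset.sum_biUnion (pairwiseDisjoint_subtree hA), ← hB, cutValue_eq,
      ← Finset.sum_insert (f := fun a => ∑ b ∈ (insert v B)ᶜ, edgeValue x a b) hvB]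
  have h3 : ∑ b ∈ (insert v B)ᶜ, edgeValue x v b + ∑ w ∈ A, T.parentValue x w ≤
      cutValue G x {v} := by
    rw [sum_parentValue x hA, cutValue_singleton, ← Finset.sum_union]
    · exact Finset.sum_le_sum_of_subset_of_nonneg (Finset.subset_univ _)
        fun a _ _ => edgeValue_nonneg hx.1 _ _
    · exact Finset.disjoint_left.mpr fun a ha hb =>
        Finset.mem_compl.mp ha (Finset.mem_insert_of_mem hb)
  have h4 : ∑ w ∈ A, ∑ a ∈ T.subtree w, ∑ b ∈ (insert v B)ᶜ, edgeValue x a b ≤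
      ∑ w ∈ A, T.aboveValue x w := by
    refine Finset.sum_le_sum fun w hw => Finset.sum_le_sum fun a _ =>
      Finset.sum_le_sum_of_subset_of_nonneg (fun b hb => ?_) fun a _ _ => edgeValue_nonneg hx.1 _ _
    rw [Finset.mem_compl, Finset.mem_insert, not_or] at hb
    rw [Finset.mem_erase, Finset.mem_compl, (mem_children.mp (hA hw)).2]
    exact ⟨hb.1, fun h => hb.2 (Finset.mem_biUnion.mpr ⟨w, hw, h⟩)⟩
  rw [Finset.sum_sub_distrib]
  linarith

/-- Each edge from the subtree of `w` past its parent is a back-arc whose cycle runs through the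
upper arc. Truncating the edges one by one loses no more than truncating their total. Hence the
deficit at `w` is at most `max (1 - aboveValue) 0`. -/
lemma min_aboveValue_le_upperFlow {x : G.edgeSet → ℝ} (hx : ∀ e, 0 ≤ x e)
    (w : {w : V // w ≠ T.root ∧ T.parent w ≠ T.root}) :
    min (T.aboveValue x w) 1 ≤ upperFlow (T.coreFlow x) w := by
  classical
  have : Nonempty T.Node := ⟨Sum.inl T.root⟩
  set P : Finset (V × V) := (T.subtree w ×ˢ (T.subtree w)ᶜ.erase (T.parent w)).filter
    fun p => G.Adj p.1 p.2 with hP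
  have h1 : T.aboveValue x w = ∑ p ∈ P, edgeValue x p.1 p.2 := by
    rw [hP, Finset.sum_filter_of_ne (fun p _ hp => by
      by_contra h
      exact hp (edgeValue_of_not_adj x h)), Finset.sum_product', aboveValue]
  have h2 : ∀ p : V × V, p ∈ P → ∃ q, T.BackArc (Sum.inl p.1) q ∧ T.base q = p.2 ∧
      T.Reach q (Sum.inl (T.parent w)) ∧ T.IsAncestor w p.1 := by
    intro p hp
    simp only [hP, Finset.mem_filter, Finset.mem_product, Finset.mem_erase, Finset.mem_compl,
      mem_subtree] at hp
    obtain ⟨⟨ha, hne, ht⟩, hat⟩ := hp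
    obtain ⟨q, h1, h2, h3⟩ := exists_backArc_of_adj ha (isAncestor_parent_of_adj ha ht hat) hne hat
    exact ⟨q, h1, h2, h3, ha⟩
  choose! q hq using h2
  rw [h1]
  refine (Finset.min_sum_one_le P fun p _ => edgeValue_nonneg hx _ _).trans ?_
  have hinj : Set.InjOn (fun p : V × V => ((Sum.inl p.1, q p) : T.Node × T.Node)) P := by
    intro p hp p' hp' h
    simp only [Prod.mk.injEq, Sum.inl.injEq] at h
    exact Prod.ext h.1 (by rw [← (hq p hp).2.1, ← (hq p' hp').2.1, h.2])
  calc ∑ p ∈ P, min (edgeValue x p.1 p.2) 1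
      = ∑ a ∈ P.image fun p : V × V => ((Sum.inl p.1, q p) : T.Node × T.Node),
          min (edgeValue x (T.base a.1) (T.base a.2)) 1 *
            T.cycleFlow a.1 a.2 (Sum.inl (T.parent w)) (Sum.inr w) := by
        rw [Finset.sum_image hinj]
        refine Finset.sum_congr rfl fun p hp => ?_
        obtain ⟨-, h2, h3, h4⟩ := hq p hp
        have h5 : T.cycleFlow (Sum.inl p.1) (q p) (Sum.inl (T.parent w)) (Sum.inr w) = 1 :=
          if_pos (Or.inr ⟨.upper w, h3, (TreeArc.lower w).reach.trans h4.reach⟩)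
        rw [h5, mul_one, h2]
        rfl
    _ ≤ _ := by
        refine Finset.sum_le_sum_of_subset_of_nonneg (fun a ha => ?_) fun a _ _ =>
          mul_nonneg (min_edgeValue_nonneg hx _ _) (cycleFlow_nonneg _ _ _ _)
        obtain ⟨p, hp, rfl⟩ := Finset.mem_image.mp ha
        exact Finset.mem_filter.mpr ⟨Finset.mem_univ _, (hq p hp).1⟩

lemma coreFlow_of_backArc (x : G.edgeSet → ℝ) {p q : T.Node} (h : T.BackArc p q) :
    T.coreFlow x p q = min (edgeValue x (T.base p) (T.base q)) 1 := by
  classical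
  unfold coreFlow
  rw [Finset.sum_eq_single (p, q)]
  · rw [cycleFlow_of_backArc h, if_pos ⟨rfl, rfl⟩, mul_one]
  · intro a _ hne
    rw [cycleFlow_of_backArc h, if_neg, mul_zero]
    rintro ⟨rfl, rfl⟩
    exact hne rfl
  · intro hn
    exact absurd (Finset.mem_filter.mpr ⟨Finset.mem_univ (p, q), h⟩) hn

/-- The core inflow of an in-vertex whose back-arcs come from the subtree of `w`. -/
lemma backInflow_coreFlow (x : G.edgeSet → ℝ) {v : T.Node} {w : V} (hv : T.base v = T.parent w)
    (h : ∀ u, T.BackArc (Sum.inl u) v ↔ u ∈ T.backTails w) :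
    T.backInflow (T.coreFlow x) v = T.coreInflow x w := by
  classical
  have h1 : ∀ p : T.Node, T.BackArc p v → T.coreFlow x p v =
      min (edgeValue x (T.base p) (T.parent w)) 1 := fun p hp => by
    rw [coreFlow_of_backArc x hp, hv]
  unfold backInflow coreInflow
  rw [Finset.sum_congr rfl fun p hp => h1 p (Finset.mem_filter.mp hp).2, Finset.sum_filter,
    Fintype.sum_sum_type, Finset.sum_eq_zero (s := Finset.univ (α := {w : V // _}))]
  · rw [add_zero, ← Finset.sum_filter]
    refine Finset.sum_congr ?_ fun a _ => rfl
    ext u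
    simp [h]
  · intro u _
    rw [if_neg]
    intro hu
    cases hu

lemma backInflow_coreFlow_inr (x : G.edgeSet → ℝ)
    (w : {w : V // w ≠ T.root ∧ T.parent w ≠ T.root}) :
    T.backInflow (T.coreFlow x) (Sum.inr w) = T.coreInflow x w := by
  refine backInflow_coreFlow x rfl fun u => ?_
  rw [mem_backTails]
  constructor
  · intro h
    cases h with
    | toNew u w h hu hwu => exact ⟨hwu, hu, h⟩
  · rintro ⟨h1, h2, h3⟩
    exact .toNew u w h3 h2 h1

/-- The root has only one child, so it behaves like the new vertex on the arc to that child. -/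
lemma backInflow_coreFlow_root (hG : TwoVertexConnected G) (x : G.edgeSet → ℝ) {w : V}
    (hw : w ≠ T.root) (hpw : T.parent w = T.root) :
    T.backInflow (T.coreFlow x) (Sum.inl T.root) = T.coreInflow x w := by
  refine backInflow_coreFlow x hpw.symm fun u => ?_
  rw [mem_backTails, hpw]
  constructor
  · intro h
    generalize hq : (Sum.inl T.root : T.Node) = q at h
    cases h with
    | toRoot u h hu => exact ⟨isAncestor_of_parent_eq_root hG hw hpw h.ne, fun e => hu (e ▸ hpw), h⟩
    | toNew u w h hu hwu => cases hq
  · rintro ⟨h1, h2, h3⟩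
    refine .toRoot u h3 fun hu => h2 ?_
    exact (eq_of_isAncestor_of_parent_eq hw h3.ne (hpw.trans hu.symm) h1 (.refl T u)).symm

open Classical in
lemma cost_coreFlow (hG : TwoVertexConnected G) (x : G.edgeSet → ℝ) {w : V}
    (hw : w ≠ T.root) (hpw : T.parent w = T.root) :
    T.cost (T.coreFlow x) = max (T.coreInflow x w - 1) 0 +
      ∑ w : {w : V // w ≠ T.root ∧ T.parent w ≠ T.root}, max (T.coreInflow x w - 1) 0 := by
  unfold cost
  rw [Finset.sum_filter, Fintype.sum_sum_type]
  congr 1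
  · rw [Finset.sum_eq_single T.root]
    · rw [if_pos (by rfl), backInflow_coreFlow_root hG x hw hpw]
    · intro v _ hv
      exact if_neg hv
    · simp
  · refine Finset.sum_congr (by congr!) fun w _ => ?_
    rw [if_pos (isIn_inr w), backInflow_coreFlow_inr]

/-! ### The charging argument. -/

open Classical in
/-- Tree edges and back-arcs are distinct edges of `G`. -/
lemma sum_card_backTails_le :
    ∑ w with w ≠ T.root, ((T.backTails w).card + 1) ≤ Fintype.card G.edgeSet := by
  have h1 : ∀ w, (insert w (T.backTails w)).card = (T.backTails w).card + 1 := fun w =>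
    Finset.card_insert_of_notMem fun h => (mem_backTails.mp h).2.1 rfl
  simp_rw [← h1]
  rw [← Finset.card_sigma, ← Set.toFinset_card]
  have h2 : ∀ p : (_ : V) × V, p ∈ (Finset.univ.filter fun w => w ≠ T.root).sigma
      (fun w => insert w (T.backTails w)) →
      p.1 ≠ T.root ∧ T.IsAncestor p.1 p.2 ∧ G.Adj p.2 (T.parent p.1) := by
    rintro ⟨w, a⟩ hp
    simp only [Finset.mem_sigma, Finset.mem_filter, Finset.mem_univ, true_and, Finset.mem_insert,
      mem_backTails] at hp
    obtain ⟨h1, rfl | h2⟩ := hp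
    exacts [⟨h1, .refl T _, (T.adj_parent _ h1).symm⟩, ⟨h1, h2.1, h2.2.2⟩]
  refine Finset.card_le_card_of_injOn (fun p => s(p.2, T.parent p.1)) (fun p hp => ?_) ?_
  · simpa using (h2 p hp).2.2
  · rintro ⟨w, a⟩ hp ⟨w', a'⟩ hp' h
    obtain ⟨h3, h4, -⟩ := h2 _ hp
    obtain ⟨h5, h6, -⟩ := h2 _ hp'
    simp only at h h3 h4 h5 h6
    -- The lower end of the edge is the tail and the upper end the parent, and the child is the one
    -- on the path between them. Swapped ends contradict the discovery times.
    rcases Sym2.eq_iff.mp h with ⟨rfl, h7⟩ | ⟨h7, h8⟩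
    · rw [eq_of_isAncestor_of_parent_eq h3 h5 h7 h4 h6]
    · have h9 := T.disc_parent_lt w h3
      have h10 := T.disc_parent_lt w' h5
      have h11 := h4.disc_le
      have h12 := h6.disc_le
      rw [h8] at h9
      rw [← h7] at h10
      omega

/-- The cost that arises at a child of a vertex is paid by its `k` back-arcs and by the excess
of a cut: `m` is the truncated value of the tree edge, `b` the core inflow, `q` and `u` are the
values of the edges that go from the subtree to the parent and above it. -/
lemma local_cost_le {k : ℕ} {m b q u : ℝ} (hm : m ≤ 1) (hm0 : 0 ≤ m) (hb : b ≤ k * m)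
    (hq : m + b ≤ q) (hqu : 2 ≤ q + u) (hu : 0 ≤ u) :
    max (b - 1) 0 + max (1 - u) 0 - k / 6 ≤ 5 / 6 * max (q - u) 0 ∨
      max (b - 1) 0 + max (1 - u) 0 - k / 6 ≤ 5 / 6 * (q - 2) := by
  have hk : (0 : ℝ) ≤ k := k.cast_nonneg
  have hkm : k * m ≤ k := mul_le_of_le_one_right hk hm
  rcases le_total 1 u with h | h
  · rw [max_eq_right (by linarith : 1 - u ≤ 0), add_zero]
    rcases le_total b 1 with h' | h'
    · rw [max_eq_right (by linarith : b - 1 ≤ 0)]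
      exact Or.inl (by linarith [le_max_right (q - u) 0])
    · rw [max_eq_left (by linarith : 0 ≤ b - 1)]
      by_cases h6 : b - 1 ≤ k / 6
      · exact Or.inl (by linarith [le_max_right (q - u) 0])
      · refine Or.inr ?_
        -- Inserting `q ≥ m + b` and then `b ≤ k * m` into the second alternative leaves exactly
        -- this inequality.
        suffices h7 : (5 - k) * (1 - m) ≤ 1 by linarith
        by_cases h5 : 5 ≤ k
        · have h5' : (5 : ℝ) ≤ k := by exact_mod_cast h5
          linarith [mul_nonneg (sub_nonneg.mpr h5') (sub_nonneg.mpr hm)]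
        · have h5' : k < 5 := by omega
          -- From `b - 1 > k / 6` and `b ≤ k * m` one gets `m > 1 / k + 1 / 6` for `k ≥ 1`. This is
          -- impossible for `k = 1`, and `k = 0` contradicts `b > 1`. For `k = 2` and `k = 3` the
          -- resulting bound is exactly 1, so the constants 1/6 and 5/6 have no slack there.
          interval_cases k <;> norm_num at * <;> linarith
  · rw [max_eq_left (by linarith : 0 ≤ 1 - u)]
    -- For `b ≤ 1`, the cut constraint gives `q - u ≥ 2 * (1 - u)`. For `b ≥ 1`, the two maxima add
    -- up to `b - u`, and `b ≤ k` pays for the missing sixth.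
    refine Or.inl ?_
    have h1 := le_max_left (q - u) 0
    rcases le_total b 1 with h' | h'
    · rw [max_eq_right (by linarith : b - 1 ≤ 0)]
      linarith
    · rw [max_eq_left (by linarith : 0 ≤ b - 1)]
      linarith

lemma cost_child_le {x : G.edgeSet → ℝ} (hx : x ∈ feasible G) (hT : T.FollowsHighest x) {w : V}
    (hw : w ≠ T.root) :
    max (T.coreInflow x w - 1) 0 + max (1 - T.aboveValue x w) 0 - (T.backTails w).card / 6 ≤
        5 / 6 * max (T.parentValue x w - T.aboveValue x w) 0 ∨
      max (T.coreInflow x w - 1) 0 + max (1 - T.aboveValue x w) 0 - (T.backTails w).card / 6 ≤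
        5 / 6 * (T.parentValue x w - 2) :=
  local_cost_le (min_le_right _ _) (min_edgeValue_nonneg hx.1 (T.parent w) w) (coreInflow_le hT hw)
    (coreInflow_add_le_parentValue hx.1 w) (two_le_parentValue_add_aboveValue hx hw)
    (aboveValue_nonneg hx.1 w)

lemma two_le_cutValue_singleton (hG : TwoVertexConnected G) {x : G.edgeSet → ℝ}
    (hx : x ∈ feasible G) (v : V) : 2 ≤ cutValue G x {v} := by
  refine hx.2 _ (Finset.singleton_nonempty v) fun h => ?_
  have h1 := congrArg Finset.card h
  rw [Finset.card_singleton, Finset.card_univ] at h1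
  have := hG.1
  omega

lemma sum_cost_children_le {x : G.edgeSet → ℝ} (hx : x ∈ feasible G) (hT : T.FollowsHighest x)
    {v : V} (hv : v ≠ T.root) :
    ∑ w ∈ T.children v, (max (T.coreInflow x w - 1) 0 + max (1 - T.aboveValue x w) 0 -
      (T.backTails w).card / 6) ≤ 5 / 6 * (cutValue G x {v} - 2) := by
  classical
  have hw : ∀ w ∈ T.children v, w ≠ T.root := fun w hw => (mem_children.mp hw).1
  by_cases h : ∀ w ∈ T.children v, max (T.coreInflow x w - 1) 0 + max (1 - T.aboveValue x w) 0 -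
      (T.backTails w).card / 6 ≤ 5 / 6 * max (T.parentValue x w - T.aboveValue x w) 0
  · refine (Finset.sum_le_sum h).trans ?_
    rw [← Finset.mul_sum]
    refine mul_le_mul_of_nonneg_left ?_ (by norm_num)
    -- Only the subtrees with `q ≥ u` are joined to `v`, so that the sum of the positive parts is a
    -- sum of differences.
    refine le_trans (le_of_eq ?_) (sum_parentValue_sub_aboveValue_le hx hv
      (Finset.filter_subset (fun w => 0 ≤ T.parentValue x w - T.aboveValue x w) (T.children v)))
    rw [Finset.sum_filter]
    refine Finset.sum_congr rfl fun w _ => ?_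
    split_ifs with h1
    exacts [max_eq_left h1, max_eq_right (by linarith)]
  · push Not at h
    obtain ⟨w, hwc, h1⟩ := h
    -- One child with the bound `5 / 6 * (q - 2)` already provides the term `-2`; for the others `5
    -- / 6 * q` suffices.
    have h2 := (cost_child_le hx hT (hw w hwc)).resolve_left (not_le.mpr h1)
    have h3 : ∑ w ∈ (T.children v).erase w, (max (T.coreInflow x w - 1) 0 +
        max (1 - T.aboveValue x w) 0 - (T.backTails w).card / 6) ≤
        ∑ w ∈ (T.children v).erase w, 5 / 6 * T.parentValue x w := by
      refine Finset.sum_le_sum fun w' hw' => ?_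
      have h4 := parentValue_nonneg (T := T) hx.1 w'
      have h5 := aboveValue_nonneg (T := T) hx.1 w'
      have h6 : max (T.parentValue x w' - T.aboveValue x w') 0 ≤ T.parentValue x w' :=
        max_le (by linarith) h4
      rcases cost_child_le hx hT (hw w' (Finset.mem_of_mem_erase hw')) with h7 | h7 <;> linarith
    have h4 := sum_parentValue_le (T := T) hx.1 v
    rw [← Finset.add_sum_erase _ _ hwc] at h4 ⊢
    rw [← Finset.mul_sum] at h3
    linarith

lemma cost_root_le (hG : TwoVertexConnected G) {x : G.edgeSet → ℝ} (hx : x ∈ feasible G)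
    (hT : T.FollowsHighest x) {w : V} (hw : w ≠ T.root) (hpw : T.parent w = T.root) :
    max (T.coreInflow x w - 1) 0 - (T.backTails w).card / 6 ≤
      5 / 6 * (cutValue G x {T.root} - 2) := by
  -- No arc from an out-vertex to an in-vertex lies above the child of the root. The value `u = 2`
  -- switches the deficit term off and makes both alternatives comparable with `q - 2`.
  have h1 := local_cost_le (u := 2) (min_le_right _ _)
    (min_edgeValue_nonneg hx.1 (T.parent w) w) (coreInflow_le hT hw)
    (coreInflow_add_le_parentValue hx.1 w)
    (by linarith [parentValue_nonneg (T := T) hx.1 w]) (by norm_num)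
  have h2 := two_le_cutValue_singleton hG hx T.root
  have h3 : T.parentValue x w ≤ cutValue G x {T.root} :=
    (Finset.single_le_sum (fun w _ => parentValue_nonneg hx.1 w)
      (mem_children.mpr ⟨hw, hpw⟩)).trans (sum_parentValue_le hx.1 T.root)
  have h4 : max (T.parentValue x w - 2) 0 ≤ cutValue G x {T.root} - 2 :=
    max_le (by linarith) (by linarith)
  rw [show max ((1 : ℝ) - 2) 0 = 0 by norm_num, add_zero] at h1
  rcases h1 with h1 | h1 <;> linarith

lemma children_root (hG : TwoVertexConnected G) {w : V} (hw : w ≠ T.root)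
    (hpw : T.parent w = T.root) : T.children T.root = {w} := by
  ext w'
  rw [mem_children, Finset.mem_singleton]
  constructor
  · rintro ⟨h1, h2⟩
    exact (eq_of_isAncestor_of_parent_eq hw h1 (hpw.trans h2.symm)
      (isAncestor_of_parent_eq_root hG hw hpw h1) (.refl T w')).symm
  · rintro rfl
    exact ⟨hw, hpw⟩

open Classical in
lemma sum_ne_root {M : Type*} [AddCommMonoid M] (F : V → M) :
    ∑ w with w ≠ T.root, F w = ∑ v, ∑ w ∈ T.children v, F w := by
  rw [← Finset.sum_fiberwise_of_maps_to (g := T.parent) (t := Finset.univ) (by simp)]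
  refine Finset.sum_congr rfl fun v _ => Finset.sum_congr ?_ fun _ _ => rfl
  ext w
  simp [mem_children]

open Classical in
lemma sum_parent_ne_root (F : V → ℝ) {w₀ : V} (h₀ : T.children T.root = {w₀}) :
    ∑ w : {w : V // w ≠ T.root ∧ T.parent w ≠ T.root}, F w + F w₀ =
      ∑ v, ∑ w ∈ T.children v, F w := by
  rw [← Finset.add_sum_erase _ _ (Finset.mem_univ T.root), h₀, Finset.sum_singleton, add_comm]
  congr 1
  rw [← Finset.sum_subtype (Finset.univ.filter fun w => w ≠ T.root ∧ T.parent w ≠ T.root)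
    (by simp) F, ← Finset.sum_fiberwise_of_maps_to (g := T.parent) (t := Finset.univ.erase T.root)
    (by simp)]
  refine Finset.sum_congr rfl fun v hv => Finset.sum_congr ?_ fun _ _ => rfl
  ext w
  simp only [Finset.mem_filter, Finset.mem_univ, true_and, mem_children]
  constructor
  · rintro ⟨⟨h1, -⟩, h2⟩
    exact ⟨h1, h2⟩
  · rintro ⟨h1, rfl⟩
    exact ⟨⟨h1, (Finset.mem_erase.mp hv).1⟩, rfl⟩

lemma cost_add_deficit_le (hG : TwoVertexConnected G) {x : G.edgeSet → ℝ}
    (hx : IsExtremeOptimal G x) (hpos : ∀ e, 0 < x e) (hT : T.FollowsHighest x) :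
    T.cost (T.coreFlow x) + deficit (T.coreFlow x) ≤
      5 / 3 * optLP G - 3 / 2 * (Fintype.card V : ℝ) := by
  classical
  have hf := hx.1.1
  have : Nonempty V := ⟨T.root⟩
  obtain ⟨w₀, hw₀, hpw₀⟩ := exists_child_root (T := T) hG
  have h₀ := children_root hG hw₀ hpw₀
  set c : V → ℝ := fun w => max (T.coreInflow x w - 1) 0 + max (1 - T.aboveValue x w) 0 with hc
  set k : V → ℝ := fun w => ((T.backTails w).card : ℝ) with hk
  have h1 : T.cost (T.coreFlow x) + deficit (T.coreFlow x) ≤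
      max (T.coreInflow x w₀ - 1) 0 +
        ∑ w : {w : V // w ≠ T.root ∧ T.parent w ≠ T.root}, c w := by
    rw [cost_coreFlow hG x hw₀ hpw₀, add_assoc, deficit, ← Finset.sum_add_distrib]
    refine add_le_add le_rfl (Finset.sum_le_sum fun w _ => add_le_add le_rfl ?_)
    have h := min_aboveValue_le_upperFlow hf.1 w
    rcases le_total (T.aboveValue x w) 1 with h' | h'
    · rw [min_eq_left h'] at h
      exact max_le_max (by linarith) le_rfl
    · rw [min_eq_right h'] at h
      exact max_le ((by linarith : _ ≤ (0 : ℝ)).trans (le_max_right _ _)) (le_max_right _ _)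
  -- `c w₀` contains a deficit term that does not occur in the network. The extra summand at the
  -- root admits it here, and it cancels when `w₀` is split off from the sum.
  have h2 : ∑ v, ∑ w ∈ T.children v, (c w - k w / 6) ≤
      ∑ v, (5 / 6 * (cutValue G x {v} - 2) +
        if v = T.root then c w₀ - max (T.coreInflow x w₀ - 1) 0 else 0) := by
    refine Finset.sum_le_sum fun v _ => ?_
    split_ifs with hv
    · subst hv
      rw [h₀, Finset.sum_singleton]
      have := cost_root_le hG hf hT hw₀ hpw₀
      simp only [hk]
      linarith
    · rw [add_zero]
      exact sum_cost_children_le hf hT hv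
  rw [Finset.sum_add_distrib, Finset.sum_ite_eq', if_pos (Finset.mem_univ _), ← Finset.mul_sum,
    Finset.sum_sub_distrib, sum_cutValue_singleton, objective_eq_optLP hx, Finset.sum_const,
    Finset.card_univ, nsmul_eq_mul] at h2
  simp_rw [Finset.sum_sub_distrib] at h2
  rw [← sum_parent_ne_root c h₀, ← sum_ne_root (fun w => k w / 6), ← Finset.sum_div] at h2
  -- There are at most `2 n - 2` edges, of which `n - 1` are tree edges; so there are at most `n -
  -- 1` back-arcs.
  have h3 : ∑ w with w ≠ T.root, k w + (Fintype.card V - 1) + 2 ≤ 2 * (Fintype.card V : ℝ) := by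
    have h4 := (Nat.add_le_add_right (sum_card_backTails_le (T := T)) 2).trans
      (card_edgeSet_le hx.1 hpos)
    rw [Finset.sum_add_distrib, Finset.sum_const, smul_eq_mul, mul_one,
      Finset.filter_ne', Finset.card_erase_of_mem (Finset.mem_univ _), Finset.card_univ] at h4
    have h5 : 1 ≤ Fintype.card V := Fintype.card_pos
    have h6 : ((∑ w ∈ Finset.univ.erase T.root, (T.backTails w).card + (Fintype.card V - 1) + 2 : ℕ)
      : ℝ) ≤ ((2 * Fintype.card V : ℕ) : ℝ) := by exact_mod_cast h4
    push_cast [Nat.cast_sub h5] at h6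
    rw [Finset.filter_ne']
    exact h6
  linarith

end DFSTree

theorem mainTheorem3 {V : Type*} [Fintype V] (G : SimpleGraph V) (hG : TwoVertexConnected G)
    (x : G.edgeSet → ℝ) (hx : HeldKarp.IsExtremeOptimal G x) (hpos : ∀ e, 0 < x e)
    (T : DFSTree G) (hT : T.FollowsHighest x) :
    (∃ f'' : T.Node → T.Node → ℝ, T.IsCorrection x f'') ∧
    ∀ f'' : T.Node → T.Node → ℝ, T.IsCorrection x f'' →
      T.IsCirculation (T.coreFlow x + f'') ∧
      T.cost (T.coreFlow x + f'') ≤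
        5 / 3 * HeldKarp.optLP G - 3 / 2 * (Fintype.card V : ℝ) :=
  ⟨DFSTree.exists_isCorrection hG x, fun _ hg =>
    ⟨hg.isCirculation hG fun e => (hpos e).le,
      hg.cost_le.trans (DFSTree.cost_add_deficit_le hG hx hpos hT)⟩⟩
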